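/- Setting. Let $\Theta\subseteq\mathbb R$ be an interval; derivatives of functions on $\Theta$ are taken within $\Theta$ (one-sided at end points). For a kernel $\mathcal K:\Theta^2\to\mathbb R$ put $g_{\mathcal K}(\theta)=\partial^2_{x,y}\mathcal K(\theta,\theta)$ and, where $g_{\mathcal K}>0$, $\mathfrak d_{\mathcal K}(\theta,\theta')=\bigl|\int_{\theta'}^{\theta}\sqrt{g_{\mathcal K}(t)}\,dt\bigr|$. The covariant derivatives are $D_{0,0}=\mathcal K$, $D_{i+1,j}(x,y)=g_{\mathcal K}(x)^{i/2}\,\partial_x\bigl(D_{i,j}(x,y)\,g_{\mathcal K}(x)^{-i/2}\bigr)$, $D_{0,j+1}(x,y)=g_{\mathcal K}(y)^{j/2}\,\partial_y\bigl(D_{0,j}(x,y)\,g_{\mathcal K}(y)^{-j/2}\bigr)$; further $\mathcal K^{[i,j]}(x,y)=D_{i,j}(x,y)\,g_{\mathcal K}(x)^{-i/2}g_{\mathcal K}(y)^{-j/2}$ and $h_{\mathcal K}(\theta)=\mathcal K^{[3,3]}(\theta,\theta)$. A kernel is of class $\mathcal C^{0,0}$ if it is continuous on $\Theta^2$; recursively,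 it is of class $\mathcal C^{i,j}$ if it is continuous and, when $i\ge1$, it is $\mathcal C^i$ in the first variable with $\partial_x$-derivative of class $\mathcal C^{i-1,j}$ and, when $j\ge1$, it is $\mathcal C^j$ in the second variable with $\partial_y$-derivative of class $\mathcal C^{i,j-1}$. Limit kernel. Let $\mathcal K_\infty$ be a symmetric kernel on $\Theta^2$ of class $\mathcal C^{3,3}$, with $g_\infty:=g_{\mathcal K_\infty}$ positive and of class $\mathcal C^2$ on $\Theta$ and $\mathcal K_\infty(\theta,\theta)=-\mathcal K_\infty^{[2,0]}(\theta,\theta)=1$ for $\theta\in\Theta$. Let $\Theta_\infty\subseteq\Theta$ be an interval with $\inf_{\Theta_\infty}g_\infty>0$, $L_3:=\sup_{\Theta_\infty}h_{\mathcal K_\infty}<\infty$ and $L_{i,j}:=\sup_{\Theta_\infty^2}|\mathcal K_\infty^{[i,j]}|<\infty$ for $i,j\in\{0,1,2\}$. Let $r>0$, and let $C_N,C_N',C_F,C_B,c_N,c_F,c_B$ be positive constants with $C_F<1$ (regarded as attached to $\mathcal K_\infty$ and $r$). Theorem. There are finite positive constants $\mathcal C_0,\mathcal C_1,\mathcal C_2,\mathcal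 C_3$, depending only on $\mathcal K_\infty$ (on $\Theta$ and $\Theta_\infty$), on $r$ and on the constants $C_N,\dots,c_B$ attached to them, such that the following holds. Let $H_T$ be a real Hilbert space and $\varphi_T:\Theta\to H_T$ of class $\mathcal C^3$ and nowhere zero; put $\phi_T=\varphi_T/\|\varphi_T\|_T$ and assume $\|\partial_\theta\phi_T\|_T^2>0$ on $\Theta$. Let $\mathcal K_T(\theta,\theta')=\langle\phi_T(\theta),\phi_T(\theta')\rangle_T$, $\mathfrak d_T=\mathfrak d_{\mathcal K_T}$, and let $\Theta_T=[a,b]\subseteq\Theta_\infty$ be a compact interval such that $$\max\Bigl(\max_{i,j\le2}\sup_{\Theta_T^2}|\mathcal K_T^{[i,j]}-\mathcal K_\infty^{[i,j]}|,\ \sup_{\Theta_T}|h_{\mathcal K_T}-h_{\mathcal K_\infty}|\Bigr)\le\min(L_{2,2},L_3).$$ Let $\beta^\star\in\mathbb R^K$, $\vartheta^\star\in\Theta_T^K$, $S^\star=\{k:\beta^\star_k\ne0\}$, $s=\operatorname{Card}S^\star\ge1$, $\mathcal Q^\star=\{\theta_k^\star:k\in S^\star\}$. Assume that $\mathcal Q^\star$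 has cardinality $s$, that $\mathfrak d_T(\theta,\theta')>2r$ for all distinct $\theta,\theta'\in\mathcal Q^\star$, and, with $\mathcal B_T(\theta,r)=\{\theta'\in\Theta_T:\mathfrak d_T(\theta,\theta')\le r\}$, that for every $v:\mathcal Q^\star\to\{-1,1\}$ there are $p,q\in H_T$ with $\|p\|_T\le C_B\sqrt s$ and $\|q\|_T\le c_B\sqrt s$ such that - for all $\theta^\star\in\mathcal Q^\star$ and $\theta\in\mathcal B_T(\theta^\star,r)$: $|\langle\phi_T(\theta),p\rangle_T|\le1-C_N\mathfrak d_T(\theta^\star,\theta)^2$, $|\langle\phi_T(\theta),p\rangle_T-v(\theta^\star)|\le C_N'\mathfrak d_T(\theta^\star,\theta)^2$, and $|\langle\phi_T(\theta),q\rangle_T-v(\theta^\star)\operatorname{sign}(\theta-\theta^\star)\mathfrak d_T(\theta,\theta^\star)|\le c_N\mathfrak d_T(\theta^\star,\theta)^2$; - for all $\theta\in\Theta_T\setminus\bigcup_{\theta^\star\in\mathcal Q^\star}\mathcal B_T(\theta^\star,r)$: $|\langle\phi_T(\theta),p\rangle_T|\le1-C_F$ and $|\langle\phi_T(\theta),q\rangle_T|\le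 c_F$. Let $w_T$ be a random element of $H_T$ such that, for some $\sigma,\Delta_T>0$ and every $f\in H_T$, $\langle f,w_T\rangle_T$ is a centered (possibly degenerate) Gaussian variable with $\operatorname{Var}\langle f,w_T\rangle_T\le\sigma^2\Delta_T\|f\|_T^2$. Write $\beta\Phi_T(\vartheta)=\sum_{k=1}^K\beta_k\phi_T(\theta_k)$, and observe $y=\beta^\star\Phi_T(\vartheta^\star)+w_T$. Let $\tau>0$ and $\kappa>0$ with $\kappa\ge\mathcal C_1\sigma\sqrt{\Delta_T\log\tau}$, and let $(\hat\beta,\hat\vartheta)$ be any minimizer of $\frac12\|y-\beta\Phi_T(\vartheta)\|_T^2+\kappa\|\beta\|_{\ell_1}$ over $\beta\in\mathbb R^K$, $\vartheta\in\Theta_T^K$. Then there is an event of probability at least $$1-\mathcal C_2\left(\frac{\mathfrak d_T(a,b)}{\tau\sqrt{\log\tau}}\vee\frac1\tau\right)$$ on which both $$\|\hat\beta\Phi_T(\hat\vartheta)-\beta^\star\Phi_T(\vartheta^\star)\|_T\le\mathcal C_0\sqrt s\,\kappa\qquad\text{and}\qquad\bigl|\|\hat\beta\|_{\ell_1}-\|\beta^\star\|_{\ell_1}\bigr|\le\mathcal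 C_3\,\kappa\,s .$$ (For $\tau\le1$ the square root of a negative number and a quotient by zero are read as $0$.) -/

import Mathlib

open MeasureTheory

noncomputable section

/-! ### Kernels on an interval and their covariant derivatives

All functions of the parameter are represented by total functions on `ℝ`, but only their values on
the interval `Θ` are used: derivatives are taken within `Θ` (one-sided at end points). -/

/-- Partial derivative of a kernel in the first variable, within `Θ`. -/
def pdx (Θ : Set ℝ) (F : ℝ → ℝ → ℝ) : ℝ → ℝ → ℝ :=
  fun x y => derivWithin (fun x' => F x' y) Θ x

/-- Partial derivative of a kernel in the second variable, within `Θ`. -/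
def pdy (Θ : Set ℝ) (F : ℝ → ℝ → ℝ) : ℝ → ℝ → ℝ :=
  fun x y => derivWithin (fun y' => F x y') Θ y

/-- `F` is of class `C^{i,j}` on `Θ²`: it is continuous on `Θ²`; if `i ≥ 1`, its first-variable
slices are `C^i` on `Θ` and `∂ₓF` is of class `C^{i-1,j}`; if `j ≥ 1`, its second-variable slices
are `C^j` on `Θ` and `∂_yF` is of class `C^{i,j-1}`. -/
def ClassC (Θ : Set ℝ) : ℕ → ℕ → (ℝ → ℝ → ℝ) → Prop
  | 0, 0, F => ContinuousOn (fun z : ℝ × ℝ => F z.1 z.2) (Θ ×ˢ Θ)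
  | i + 1, 0, F => ContinuousOn (fun z : ℝ × ℝ => F z.1 z.2) (Θ ×ˢ Θ) ∧
      ((∀ y ∈ Θ, ContDiffOn ℝ ((i + 1 : ℕ) : WithTop ℕ∞) (fun x => F x y) Θ) ∧
        ClassC Θ i 0 (pdx Θ F))
  | 0, j + 1, F => ContinuousOn (fun z : ℝ × ℝ => F z.1 z.2) (Θ ×ˢ Θ) ∧
      ((∀ x ∈ Θ, ContDiffOn ℝ ((j + 1 : ℕ) : WithTop ℕ∞) (fun y => F x y) Θ) ∧
        ClassC Θ 0 j (pdy Θ F))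
  | i + 1, j + 1, F => ContinuousOn (fun z : ℝ × ℝ => F z.1 z.2) (Θ ×ˢ Θ) ∧
      ((∀ y ∈ Θ, ContDiffOn ℝ ((i + 1 : ℕ) : WithTop ℕ∞) (fun x => F x y) Θ) ∧
        ClassC Θ i (j + 1) (pdx Θ F)) ∧
      ((∀ x ∈ Θ, ContDiffOn ℝ ((j + 1 : ℕ) : WithTop ℕ∞) (fun y => F x y) Θ) ∧
        ClassC Θ (i + 1) j (pdy Θ F))
  termination_by i j => i + j

/-- The Riemannian density `g_K(θ) = ∂²_{x,y} K(θ,θ)`. -/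
def kernelG (Θ : Set ℝ) (K : ℝ → ℝ → ℝ) (θ : ℝ) : ℝ := pdx Θ (pdy Θ K) θ θ

/-- The Riemannian metric `d_K(θ,θ') = |G(θ) - G(θ')|`, with `G` a primitive of `√g_K`. -/
def kernelDist (Θ : Set ℝ) (K : ℝ → ℝ → ℝ) (θ θ' : ℝ) : ℝ :=
  |∫ t in θ'..θ, √(kernelG Θ K t)|

/-- Covariant derivatives `D_{i,j;g}[F]` with respect to a density `g`; here `√g ^ i` is
`g^{i/2}`. -/
def covD (Θ : Set ℝ) (g : ℝ → ℝ) (F : ℝ → ℝ → ℝ) : ℕ → ℕ → ℝ → ℝ → ℝ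
  | 0, 0 => F
  | 0, j + 1 => fun x y =>
      √(g y) ^ j * derivWithin (fun y' => covD Θ g F 0 j x y' / √(g y') ^ j) Θ y
  | i + 1, j => fun x y =>
      √(g x) ^ i * derivWithin (fun x' => covD Θ g F i j x' y / √(g x') ^ i) Θ x

/-- The normalized covariant derivative `K^{[i,j]}` of a kernel, with respect to its own
density. -/
def kernelCov (Θ : Set ℝ) (K : ℝ → ℝ → ℝ) (i j : ℕ) (x y : ℝ) : ℝ :=
  covD Θ (kernelG Θ K) K i j x y / (√(kernelG Θ K x) ^ i * √(kernelG Θ K y) ^ j)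

/-- `h_K(θ) = K^{[3,3]}(θ,θ)`. -/
def kernelH (Θ : Set ℝ) (K : ℝ → ℝ → ℝ) (θ : ℝ) : ℝ := kernelCov Θ K 3 3 θ θ

/-! ### The limit kernel and proximity to it -/

/-- `L_{i,j} = sup_{S²} |K^{[i,j]}|`, an extended real. -/
def kernelL (Θ S : Set ℝ) (K : ℝ → ℝ → ℝ) (i j : ℕ) : EReal :=
  ⨆ x ∈ S, ⨆ y ∈ S, ((|kernelCov Θ K i j x y| : ℝ) : EReal)

/-- `L_3 = sup_S h_K`, an extended real. -/
def kernelL3 (Θ S : Set ℝ) (K : ℝ → ℝ → ℝ) : EReal :=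
  ⨆ x ∈ S, ((kernelH Θ K x : ℝ) : EReal)

/-- Regularity of the limit kernel `K` on `Θ²`, with bounds on the sub-interval `S` (the set
`Θ_∞`). Local boundedness of `g_K` is contained in its being `C²`. -/
structure LimitKernel (Θ S : Set ℝ) (K : ℝ → ℝ → ℝ) : Prop where
  symm : ∀ x ∈ Θ, ∀ y ∈ Θ, K x y = K y x
  smooth : ClassC Θ 3 3 K
  g_pos : ∀ x ∈ Θ, 0 < kernelG Θ K x
  g_smooth : ContDiffOn ℝ 2 (kernelG Θ K) Θ
  diag : ∀ x ∈ Θ, K x x = 1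
  diag_cov : ∀ x ∈ Θ, kernelCov Θ K 2 0 x x = -1
  subset : S ⊆ Θ
  interval : S.OrdConnected
  g_inf_pos : 0 < ⨅ x ∈ S, ((kernelG Θ K x : ℝ) : EReal)
  L3_lt_top : kernelL3 Θ S K < ⊤
  L_lt_top : ∀ i ≤ 2, ∀ j ≤ 2, kernelL Θ S K i j < ⊤

/-- `V_T^{(1)} = max_{i,j ≤ 2} sup_{B²} |K_T^{[i,j]} - K_∞^{[i,j]}|`, with `B` the set `Θ_T`. -/
def kernelV1 (Θ B : Set ℝ) (KT Kinf : ℝ → ℝ → ℝ) : EReal :=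
  ⨆ i ∈ Set.Iic (2 : ℕ), ⨆ j ∈ Set.Iic (2 : ℕ), ⨆ x ∈ B, ⨆ y ∈ B,
    ((|kernelCov Θ KT i j x y - kernelCov Θ Kinf i j x y| : ℝ) : EReal)

/-- `V_T^{(2)} = sup_B |h_T - h_∞|`. -/
def kernelV2 (Θ B : Set ℝ) (KT Kinf : ℝ → ℝ → ℝ) : EReal :=
  ⨆ x ∈ B, ((|kernelH Θ KT x - kernelH Θ Kinf x| : ℝ) : EReal)

/-- Quality of the approximation: `Θ_T ⊆ Θ_∞` and
`max (V_T^{(1)}) (V_T^{(2)}) ≤ min L_{2,2} L_3`. -/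
structure CloseToLimit (Θ S B : Set ℝ) (KT Kinf : ℝ → ℝ → ℝ) : Prop where
  subset : B ⊆ S
  close : max (kernelV1 Θ B KT Kinf) (kernelV2 Θ B KT Kinf)
    ≤ min (kernelL Θ S Kinf 2 2) (kernelL3 Θ S Kinf)

/-! ### The dictionary -/

section Dictionary

variable {H : Type*} [NormedAddCommGroup H] [InnerProductSpace ℝ H]

/-- The normalized feature `φ(θ) / ‖φ(θ)‖`. -/
def feature (φ : ℝ → H) (θ : ℝ) : H := ‖φ θ‖⁻¹ • φ θ

/-- The mixture `β Φ(ϑ) = ∑ₖ βₖ φ(θₖ) / ‖φ(θₖ)‖`. -/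
def mixture {n : ℕ} (φ : ℝ → H) (β ϑ : Fin n → ℝ) : H := ∑ k, β k • feature φ (ϑ k)

/-- The kernel of the dictionary. -/
def dictKernel (φ : ℝ → H) (x y : ℝ) : ℝ := inner ℝ (feature φ x) (feature φ y)

/-- Regularity of the dictionary: `C³`, nowhere zero, and with
`g_T = ‖∂_θ (φ/‖φ‖)‖²` positive on `Θ`. -/
structure RegularDictionary (Θ : Set ℝ) (φ : ℝ → H) : Prop where
  smooth : ContDiffOn ℝ 3 φ Θ
  norm_pos : ∀ θ ∈ Θ, 0 < ‖φ θ‖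
  g_pos : ∀ θ ∈ Θ, 0 < ‖derivWithin (feature φ) Θ θ‖ ^ 2

/-- The Riemannian metric `d_T` associated with the dictionary. -/
def dictDist (Θ : Set ℝ) (φ : ℝ → H) (θ θ' : ℝ) : ℝ := kernelDist Θ (dictKernel φ) θ θ'

/-- The closed ball of `B` (the set `Θ_T`) for the metric `d_T`. -/
def dictBall (Θ B : Set ℝ) (φ : ℝ → H) (θ r : ℝ) : Set ℝ := {θ' ∈ B | dictDist Θ φ θ θ' ≤ r}

/-- `Q` is a set of `s ≥ 1` points of `B` with pairwise distances larger than `2r`. -/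
structure SeparatedSet (Θ B : Set ℝ) (φ : ℝ → H) (r : ℝ) (s : ℕ) (Q : Set ℝ) : Prop where
  one_le : 1 ≤ s
  card : Q.ncard = s
  subset : Q ⊆ B
  separated : ∀ θ ∈ Q, ∀ θ' ∈ Q, θ ≠ θ' → 2 * r < dictDist Θ φ θ θ'

/-- Existence of interpolating certificates on `Q`, with given constants. -/
structure InterpolatingCertificate (Θ B : Set ℝ) (φ : ℝ → H) (r : ℝ) (s : ℕ) (Q : Set ℝ)
    (CN CN' CF CB : ℝ) : Prop where
  sep : SeparatedSet Θ B φ r s Q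
  exists_cert : ∀ v : ℝ → ℝ, (∀ θ ∈ Q, v θ = 1 ∨ v θ = -1) → ∃ p : H,
    (∀ θs ∈ Q, ∀ θ ∈ dictBall Θ B φ θs r,
      |inner ℝ (feature φ θ) p| ≤ 1 - CN * dictDist Θ φ θs θ ^ 2) ∧
    (∀ θs ∈ Q, ∀ θ ∈ dictBall Θ B φ θs r,
      |inner ℝ (feature φ θ) p - v θs| ≤ CN' * dictDist Θ φ θs θ ^ 2) ∧
    (∀ θ ∈ B, (∀ θs ∈ Q, θ ∉ dictBall Θ B φ θs r) → |inner ℝ (feature φ θ) p| ≤ 1 - CF) ∧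
    ‖p‖ ≤ CB * √(s : ℝ)

/-- Existence of interpolating derivative certificates on `Q`, with given constants. -/
structure DerivativeCertificate (Θ B : Set ℝ) (φ : ℝ → H) (r : ℝ) (s : ℕ) (Q : Set ℝ)
    (cN cF cB : ℝ) : Prop where
  sep : SeparatedSet Θ B φ r s Q
  exists_cert : ∀ v : ℝ → ℝ, (∀ θ ∈ Q, v θ = 1 ∨ v θ = -1) → ∃ q : H,
    (∀ θs ∈ Q, ∀ θ ∈ dictBall Θ B φ θs r,
      |inner ℝ (feature φ θ) q - v θs * Real.sign (θ - θs) * dictDist Θ φ θ θs|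
        ≤ cN * dictDist Θ φ θs θ ^ 2) ∧
    (∀ θ ∈ B, (∀ θs ∈ Q, θ ∉ dictBall Θ B φ θs r) → |inner ℝ (feature φ θ) q| ≤ cF) ∧
    ‖q‖ ≤ cB * √(s : ℝ)

/-! ### The noise and the estimator -/

/-- Admissible noise: every `⟨f, w⟩` is a centered (possibly degenerate) Gaussian variable with
variance at most `σ² Δ ‖f‖²`. -/
structure AdmissibleNoise {Ω : Type*} [MeasurableSpace Ω] (P : Measure Ω) (w : Ω → H)
    (σ Δ : ℝ) : Prop where
  gaussian : ∀ f : H, ProbabilityTheory.HasGaussianLaw (fun ω => inner ℝ f (w ω)) P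
  centered : ∀ f : H, ∫ ω, inner ℝ f (w ω) ∂P = 0
  variance_le : ∀ f : H,
    ProbabilityTheory.variance (fun ω => inner ℝ f (w ω)) P ≤ σ ^ 2 * Δ * ‖f‖ ^ 2

/-- The `ℓ₁` norm. -/
def l1norm {n : ℕ} (β : Fin n → ℝ) : ℝ := ∑ k, |β k|

/-- The penalized criterion `½‖y - βΦ(ϑ)‖² + κ‖β‖₁`. -/
def criterion {n : ℕ} (φ : ℝ → H) (y : H) (κ : ℝ) (β ϑ : Fin n → ℝ) : ℝ :=
  1 / 2 * ‖y - mixture φ β ϑ‖ ^ 2 + κ * l1norm β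

/-- `(β, ϑ)` minimizes the criterion over `ℝⁿ × Bⁿ`. -/
def IsEstimator {n : ℕ} (B : Set ℝ) (φ : ℝ → H) (y : H) (κ : ℝ) (β ϑ : Fin n → ℝ) : Prop :=
  (∀ k, ϑ k ∈ B) ∧ ∀ β' ϑ' : Fin n → ℝ, (∀ k, ϑ' k ∈ B) →
    criterion φ y κ β ϑ ≤ criterion φ y κ β' ϑ'

end Dictionary

/-- The support of a vector. -/
def vecSupport {n : ℕ} (β : Fin n → ℝ) : Set (Fin n) := {k | β k ≠ 0}

end

/-! Let `h` be the difference of the two mixtures, `R = ‖h‖` and `L` the difference of their ℓ₁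
norms. Comparing the criterion at the estimator and at the truth gives `R²/2 ≤ ⟨h, w⟩ - κL`. Attach
each estimated parameter to a true atom whose ball contains it, or to none. Let `I2` be the sum of
`|β̂|` times squared distances to the atoms, `I3` the mass attached to none, and `I0`, `I1` the
total absolute errors of the masses and first moments around the atoms.

Pairing `h` with the certificate for the signs of `β⋆` gives `L ≥ CN·I2 + CF·I3 - CB√s·R`.
Certificates whose signs are those of the mass errors or of the first moments bound `I0` and `I1` by
multiples of `√s·R`, `I2` and `I3`. If `⟨φ, w⟩` and its first two arc-length derivatives are at most
`εκ` in absolute value, a second-order expansion at the atoms gives `⟨h, w⟩ ≤ εκ(I0 + I1 + I2/2 +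
I3)`. For small `ε` the gain in `L` absorbs the `I2` and `I3` terms, and both bounds follow
(`risk_bounds_of_inequalities`, `risk_bounds_of_small_noise`).

The smallness of the noise comes from chaining. Covariant derivatives of a Gram kernel are inner
products of arc-length derivatives of the feature (`covD_inner`), so proximity to the limit kernel
bounds these derivatives up to order three by a constant `M`. The three noise processes are
therefore Lipschitz in arc length, and `measure_exists_Icc_lt` gives a tail proportional to the
length of the interval plus one. -/

/-! ### Gaussian tails of the noise. -/

section Noise

variable {H : Type*} [NormedAddCommGroup H] [InnerProductSpace ℝ H]
  {Ω : Type*} [MeasurableSpace Ω] {P : Measure Ω} {w : Ω → H} {σ Δ : ℝ}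

/-- The sub-Gaussian form lets the variance be replaced by an upper bound and covers degenerate
laws. -/
theorem AdmissibleNoise.hasSubgaussianMGF (hw : AdmissibleNoise P w σ Δ) (f : H) {V : ℝ}
    (hV : σ ^ 2 * Δ * ‖f‖ ^ 2 ≤ V) :
    ProbabilityTheory.HasSubgaussianMGF (fun ω => inner ℝ f (w ω)) V.toNNReal P := by
  have hg := hw.gaussian f
  have hmap := hg.map_eq_gaussianReal
  rw [hw.centered f] at hmap
  have hvar := (hw.variance_le f).trans hV
  have hV0 : 0 ≤ V := (ProbabilityTheory.variance_nonneg _ _).trans hvar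
  refine ProbabilityTheory.HasSubgaussianMGF.of_map hg.aemeasurable (X := id) ?_
  rw [hmap]
  refine ⟨fun t => ProbabilityTheory.integrable_exp_mul_gaussianReal t, fun t => ?_⟩
  rw [ProbabilityTheory.mgf_id_gaussianReal]
  simp only [zero_mul, zero_add]
  refine Real.exp_le_exp.2 ?_
  rw [Real.coe_toNNReal _ hV0, Real.coe_toNNReal _ (ProbabilityTheory.variance_nonneg _ _)]
  gcongr

theorem AdmissibleNoise.measure_le_abs_inner [IsProbabilityMeasure P]
    (hw : AdmissibleNoise P w σ Δ) (f : H) {V u : ℝ}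
    (hV : σ ^ 2 * Δ * ‖f‖ ^ 2 ≤ V) (hV0 : 0 ≤ V) (hu : 0 ≤ u) :
    P {ω | u ≤ |inner ℝ f (w ω)|} ≤ ENNReal.ofReal (2 * Real.exp (-u ^ 2 / (2 * V))) := by
  have h := hw.hasSubgaussianMGF f hV
  have h1 := h.measure_ge_le hu
  have h2 := h.neg.measure_ge_le hu
  rw [Real.coe_toNNReal _ hV0] at h1 h2
  have hsub : {ω | u ≤ |inner ℝ f (w ω)|} ⊆
      {ω | u ≤ inner ℝ f (w ω)} ∪ {ω | u ≤ (-fun ω => inner ℝ f (w ω)) ω} := by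
    intro ω hω
    rcases le_abs.1 (show u ≤ |inner ℝ f (w ω)| from hω) with h | h
    · exact Or.inl h
    · exact Or.inr h
  have h3 : P.real {ω | u ≤ |inner ℝ f (w ω)|} ≤ 2 * Real.exp (-u ^ 2 / (2 * V)) :=
    calc _ ≤ _ := measureReal_mono hsub
      _ ≤ _ := measureReal_union_le _ _
      _ ≤ _ := add_le_add h1 h2
      _ = _ := by ring
  rw [← ofReal_measureReal]
  exact ENNReal.ofReal_le_ofReal h3

end Noise

/-! ### Dyadic chaining. -/

theorem Nat.floor_two_pow_succ_mul (n : ℕ) {t : ℝ} (ht : 0 ≤ t) :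
    ⌊(2 : ℝ) ^ (n + 1) * t⌋₊ = 2 * ⌊(2 : ℝ) ^ n * t⌋₊ ∨
      ⌊(2 : ℝ) ^ (n + 1) * t⌋₊ = 2 * ⌊(2 : ℝ) ^ n * t⌋₊ + 1 := by
  have h0 : 0 ≤ (2 : ℝ) ^ n * t := by positivity
  have h1 := Nat.floor_le h0
  have h2 := Nat.lt_floor_add_one ((2 : ℝ) ^ n * t)
  have e : (2 : ℝ) ^ (n + 1) * t = 2 * ((2 : ℝ) ^ n * t) := by ring
  rw [e]
  have h3 : 2 * ⌊(2 : ℝ) ^ n * t⌋₊ ≤ ⌊2 * ((2 : ℝ) ^ n * t)⌋₊ :=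
    Nat.le_floor (by push_cast; linarith)
  have h4 : ⌊2 * ((2 : ℝ) ^ n * t)⌋₊ < 2 * ⌊(2 : ℝ) ^ n * t⌋₊ + 2 :=
    (Nat.floor_lt (by positivity)).2 (by push_cast; linarith)
  omega

/-- Dyadic chaining for a continuous function on `[0, 1)`. -/
theorem abs_le_of_dyadic_increments {g : ℝ → ℝ} (hg : Continuous g) {u : ℝ} (hu : 0 ≤ u)
    (h0 : |g 0| ≤ u / 2)
    (h : ∀ n k : ℕ, k < 2 ^ (n + 1) →
      |g ((k + 1) / 2 ^ (n + 1)) - g (k / 2 ^ (n + 1))| ≤ u / 8 * (3 / 4) ^ n)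
    {t : ℝ} (ht : t ∈ Set.Ico (0 : ℝ) 1) : |g t| ≤ u := by
  -- `d n` truncates `t` to `n` binary digits; passing to `d (n + 1)` either does not move or
  -- crosses one dyadic cell.
  set d : ℕ → ℝ := fun n => (⌊(2 : ℝ) ^ n * t⌋₊ : ℝ) / 2 ^ n with hd
  have key : ∀ n, |g (d n)| ≤ u / 2 + u / 8 * ∑ i ∈ Finset.range n, (3 / 4 : ℝ) ^ i := by
    intro n
    induction n with
    | zero =>
      have : ⌊t⌋₊ = 0 := Nat.floor_eq_zero.2 ht.2
      simpa [hd, this] using h0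
    | succ n ih =>
      rw [Finset.sum_range_succ, mul_add]
      have hpow : (2 : ℝ) ^ (n + 1) = 2 * 2 ^ n := by ring
      rcases Nat.floor_two_pow_succ_mul n ht.1 with e | e
      · have : d (n + 1) = d n := by
          simp only [hd, e]; rw [hpow]; push_cast; field_simp
        rw [this]
        have : 0 ≤ u / 8 * (3 / 4 : ℝ) ^ n := by positivity
        linarith
      · have hk : 2 * ⌊(2 : ℝ) ^ n * t⌋₊ < 2 ^ (n + 1) := by
          have : ⌊(2 : ℝ) ^ n * t⌋₊ < 2 ^ n := by
            rw [Nat.floor_lt (by have := ht.1; positivity)]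
            push_cast
            have := ht.2
            have h2 : (0 : ℝ) < 2 ^ n := by positivity
            nlinarith
          rw [pow_succ]; omega
        have h1 := h n _ hk
        have e1 : (((2 * ⌊(2 : ℝ) ^ n * t⌋₊ : ℕ) : ℝ) + 1) / 2 ^ (n + 1) = d (n + 1) := by
          simp only [hd, e]; push_cast; rfl
        have e2 : ((2 * ⌊(2 : ℝ) ^ n * t⌋₊ : ℕ) : ℝ) / 2 ^ (n + 1) = d n := by
          simp only [hd]; rw [hpow]; push_cast; field_simp
        rw [e1, e2] at h1
        have := abs_sub_abs_le_abs_sub (g (d (n + 1))) (g (d n))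
        linarith
  have hlim : Filter.Tendsto d Filter.atTop (nhds t) := by
    have h1 := (tendsto_nat_floor_mul_div_atTop ht.1).comp
      (tendsto_pow_atTop_atTop_of_one_lt (one_lt_two (α := ℝ)))
    refine h1.congr fun n => ?_
    simp [hd, mul_comm]
  refine le_of_tendsto ((hg.tendsto t).comp hlim).abs (Filter.Eventually.of_forall fun n => ?_)
  refine (key n).trans ?_
  -- The increments contribute at most `u/8 · 4 = u/2`, the other half of the budget.
  have hs : ∑ i ∈ Finset.range n, (3 / 4 : ℝ) ^ i ≤ 4 := by
    have : Summable fun i : ℕ => (3 / 4 : ℝ) ^ i :=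
      summable_geometric_of_lt_one (by norm_num) (by norm_num)
    refine (this.sum_le_tsum _ fun i _ => by positivity).trans ?_
    rw [tsum_geometric_of_lt_one (by norm_num) (by norm_num)]
    norm_num
  nlinarith

/-- The union over about `2^n` dyadic increments is paid by their Gaussian exponent. Bernoulli gives
`(9/4)^n ≥ 1 + 5n/4`, and `2·exp(-5/4) ≤ 3/4` because `e > 8/3`. -/
theorem two_pow_mul_exp_neg_le {x : ℝ} (hx : 1 ≤ x) (n : ℕ) :
    (2 : ℝ) ^ n * Real.exp (-(x * (9 / 4) ^ n)) ≤ Real.exp (-x) * (3 / 4) ^ n := by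
  have hb : 1 + (n : ℝ) * (5 / 4) ≤ (9 / 4 : ℝ) ^ n := by
    have := one_add_mul_le_pow (show (-2 : ℝ) ≤ 5 / 4 by norm_num) n
    norm_num at this ⊢
    linarith
  have h1 : Real.exp (-(x * (9 / 4) ^ n)) ≤ Real.exp (-x) * Real.exp (-(5 / 4)) ^ n := by
    rw [← Real.exp_nat_mul, ← Real.exp_add]
    refine Real.exp_le_exp.2 ?_
    have hn : (0 : ℝ) ≤ n := n.cast_nonneg
    nlinarith
  have h2 : Real.exp (-(5 / 4)) ≤ 3 / 8 := by
    rw [Real.exp_neg]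
    refine inv_le_of_inv_le₀ (by norm_num) ?_
    have := Real.exp_one_gt_d9
    have h3 : Real.exp 1 ≤ Real.exp (5 / 4) := Real.exp_le_exp.2 (by norm_num)
    norm_num at this ⊢
    linarith
  calc (2 : ℝ) ^ n * Real.exp (-(x * (9 / 4) ^ n))
      ≤ 2 ^ n * (Real.exp (-x) * (3 / 8) ^ n) := by
        gcongr
        exact h1.trans (by gcongr)
    _ = Real.exp (-x) * (2 ^ n * (3 / 8) ^ n) := by ring
    _ = _ := by rw [← mul_pow]; norm_num

section Chaining

variable {H : Type*} [NormedAddCommGroup H] [InnerProductSpace ℝ H]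
  {Ω : Type*} [MeasurableSpace Ω] {P : Measure Ω} [IsProbabilityMeasure P] {w : Ω → H} {σ Δ : ℝ}

/-- Tail of the supremum of a Lipschitz Gaussian process over an interval of unit length. -/
theorem AdmissibleNoise.measure_exists_Ico_lt (hw : AdmissibleNoise P w σ Δ) (hσ : 0 < σ)
    (hΔ : 0 < Δ) {f : ℝ → H} {M u x : ℝ} (hM : 0 < M) (hu : 0 ≤ u)
    (hbd : ∀ t, ‖f t‖ ≤ M) (hlip : ∀ s t, ‖f s - f t‖ ≤ M * |s - t|)
    (hx : 1 ≤ x) (hxu : 32 * (σ ^ 2 * Δ * M ^ 2) * x = u ^ 2) (m : ℝ) :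
    P {ω | ∃ t ∈ Set.Ico m (m + 1), u < |inner ℝ (f t) (w ω)|}
      ≤ ENNReal.ofReal (18 * Real.exp (-x)) := by
  set V := σ ^ 2 * Δ * M ^ 2 with hV
  have hV0 : 0 < V := by positivity
  have hfc : Continuous f := by
    refine (LipschitzWith.of_dist_le_mul (K := M.toNNReal) fun s t => ?_).continuous
    rw [Real.coe_toNNReal _ hM.le, dist_eq_norm, Real.dist_eq]
    exact hlip s t
  set A0 : Set Ω := {ω | u / 2 ≤ |inner ℝ (f m) (w ω)|} with hA0
  set inc : ℕ → ℕ → H := fun n k =>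
    f (m + ((k : ℝ) + 1) / 2 ^ (n + 1)) - f (m + (k : ℝ) / 2 ^ (n + 1)) with hinc
  set A : ℕ → ℕ → Set Ω := fun n k =>
    {ω | u / 8 * (3 / 4) ^ n ≤ |inner ℝ (inc n k) (w ω)|} with hA
  have hsub : {ω | ∃ t ∈ Set.Ico m (m + 1), u < |inner ℝ (f t) (w ω)|} ⊆
      A0 ∪ ⋃ n, ⋃ k ∈ Finset.range (2 ^ (n + 1)), A n k := by
    rintro ω ⟨t, ht, hut⟩
    by_contra hω
    simp only [Set.mem_union, Set.mem_iUnion, not_or, not_exists, hA0, hA, Set.mem_ofPred_eq,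
      not_le, Finset.mem_range] at hω
    obtain ⟨h0, h1⟩ := hω
    refine hut.not_ge ?_
    have := abs_le_of_dyadic_increments (g := fun t => inner ℝ (f (m + t)) (w ω))
      (by fun_prop) hu (by simpa using h0.le) (fun n k hk => ?_) (t := t - m)
      ⟨by linarith [ht.1], by linarith [ht.2]⟩
    · simpa using this
    · have h2 := (h1 n k hk).le
      simp only [hinc, inner_sub_left] at h2
      exact h2
  have hP0 : P A0 ≤ ENNReal.ofReal (2 * Real.exp (-x)) := by
    refine (hw.measure_le_abs_inner (f m) (V := V) ?_ hV0.le (by positivity)).trans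
      (ENNReal.ofReal_le_ofReal ?_)
    · rw [hV]; gcongr; exact hbd m
    · gcongr
      rw [div_le_iff₀ (by positivity)]
      nlinarith
  have hPA : ∀ n k, P (A n k) ≤ ENNReal.ofReal (2 * Real.exp (-(x * (9 / 4) ^ n))) := by
    intro n k
    have hn : ‖inc n k‖ ≤ M / 2 ^ (n + 1) := by
      refine (hlip _ _).trans_eq ?_
      rw [show m + ((k : ℝ) + 1) / 2 ^ (n + 1) - (m + (k : ℝ) / 2 ^ (n + 1)) = 1 / 2 ^ (n + 1) by
        ring, abs_of_pos (by positivity)]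
      ring
    refine (hw.measure_le_abs_inner (inc n k) (V := V / 4 ^ (n + 1)) ?_ (by positivity)
      (by positivity)).trans (ENNReal.ofReal_le_ofReal ?_)
    · calc _ ≤ σ ^ 2 * Δ * (M / 2 ^ (n + 1)) ^ 2 := by gcongr
        _ = _ := by
          rw [hV, div_pow, ← pow_mul, mul_comm (n + 1) 2, pow_mul]
          norm_num
          ring
    -- At this level the variance is `V/4^(n+1)` and the threshold `(u/8)(3/4)^n`, so the exponent
    -- is exactly `(u²/32V)(9/4)^n = x(9/4)^n`.
    · gcongr
      refine le_of_eq ?_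
      have e : (u / 8 * (3 / 4) ^ n) ^ 2 = u ^ 2 / 64 * (9 / 16) ^ n := by
        rw [mul_pow, ← pow_mul, mul_comm n 2, pow_mul]; norm_num; ring
      have e2 : (9 / 4 : ℝ) ^ n = 4 ^ n * (9 / 16) ^ n := by rw [← mul_pow]; norm_num
      rw [e, e2, ← hxu]
      field_simp
      ring
  have hPn : ∀ n, P (⋃ k ∈ Finset.range (2 ^ (n + 1)), A n k) ≤
      ENNReal.ofReal (4 * Real.exp (-x) * (3 / 4) ^ n) := by
    intro n
    refine (measure_biUnion_finset_le _ _).trans ?_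
    refine (Finset.sum_le_sum fun k _ => hPA n k).trans ?_
    rw [Finset.sum_const, Finset.card_range, ← ENNReal.ofReal_nsmul]
    refine ENNReal.ofReal_le_ofReal ?_
    have := two_pow_mul_exp_neg_le hx n
    rw [nsmul_eq_mul]
    push_cast
    rw [pow_succ]
    linarith
  have hsum : Summable fun n : ℕ => 4 * Real.exp (-x) * (3 / 4 : ℝ) ^ n :=
    (summable_geometric_of_lt_one (by norm_num) (by norm_num)).mul_left _
  calc _ ≤ P A0 + P (⋃ n, ⋃ k ∈ Finset.range (2 ^ (n + 1)), A n k) :=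
        (measure_mono hsub).trans (measure_union_le _ _)
    _ ≤ ENNReal.ofReal (2 * Real.exp (-x)) +
        ∑' n : ℕ, ENNReal.ofReal (4 * Real.exp (-x) * (3 / 4) ^ n) := by
        gcongr
        exact (measure_iUnion_le _).trans (ENNReal.tsum_le_tsum hPn)
    _ = ENNReal.ofReal (18 * Real.exp (-x)) := by
        rw [← ENNReal.ofReal_tsum_of_nonneg (fun n => by positivity) hsum,
          ← ENNReal.ofReal_add (by positivity) (tsum_nonneg fun n => by positivity),
          tsum_mul_left, tsum_geometric_of_lt_one (by norm_num) (by norm_num)]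
        congr 1
        ring

/-- Tail of the supremum of a Gaussian process that is Lipschitz for the pseudo-distance
`|G s - G t|`, over a compact interval. -/
theorem AdmissibleNoise.measure_exists_Icc_lt (hw : AdmissibleNoise P w σ Δ) (hσ : 0 < σ)
    (hΔ : 0 < Δ) {a b : ℝ} (hab : a ≤ b) {G : ℝ → ℝ} (hG : ContinuousOn G (Set.Icc a b))
    (hGm : MonotoneOn G (Set.Icc a b)) {ψ : ℝ → H} {M u x : ℝ} (hM : 0 < M) (hu : 0 ≤ u)
    (hbd : ∀ t ∈ Set.Icc a b, ‖ψ t‖ ≤ M)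
    (hlip : ∀ s ∈ Set.Icc a b, ∀ t ∈ Set.Icc a b, ‖ψ s - ψ t‖ ≤ M * |G s - G t|)
    (hx : 1 ≤ x) (hxu : 32 * (σ ^ 2 * Δ * M ^ 2) * x = u ^ 2) :
    P {ω | ∃ t ∈ Set.Icc a b, u < |inner ℝ (ψ t) (w ω)|}
      ≤ ENNReal.ofReal (18 * (G b - G a + 1) * Real.exp (-x)) := by
  have hGab : G a ≤ G b := hGm ⟨le_rfl, hab⟩ ⟨hab, le_rfl⟩ hab
  have hsurj : ∀ y, ∃ t ∈ Set.Icc a b, G t = Set.projIcc (G a) (G b) hGab y := fun y =>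
    intermediate_value_Icc hab hG (Set.projIcc (G a) (G b) hGab y).2
  -- Reparametrization by arc length: `T` is a right inverse of `G`, extended to the line by
  -- projection. It need not be continuous; the Lipschitz bound on `ψ` alone makes `ψ ∘ T`
  -- Lipschitz.
  choose T hT hGT using hsurj
  set f : ℝ → H := fun y => ψ (T y) with hf
  have hflip : ∀ s t, ‖f s - f t‖ ≤ M * |s - t| := by
    intro s t
    refine (hlip _ (hT s) _ (hT t)).trans ?_
    rw [hGT, hGT]
    exact mul_le_mul_of_nonneg_left (Set.abs_projIcc_sub_projIcc hGab) hM.le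
  -- Points with the same `G` have the same `ψ`, so the choice of preimage is immaterial.
  have hfG : ∀ t ∈ Set.Icc a b, f (G t) = ψ t := by
    intro t ht
    have h1 := hlip _ (hT (G t)) t ht
    rw [hGT, Set.projIcc_of_mem hGab
      ⟨hGm ⟨le_rfl, hab⟩ ht ht.1, hGm ht ⟨hab, le_rfl⟩ ht.2⟩, sub_self, abs_zero, mul_zero] at h1
    exact sub_eq_zero.1 (norm_le_zero_iff.1 h1)
  set N := ⌊G b - G a⌋₊ + 1 with hN
  have hsub : {ω | ∃ t ∈ Set.Icc a b, u < |inner ℝ (ψ t) (w ω)|} ⊆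
      ⋃ i ∈ Finset.range N, {ω | ∃ t ∈ Set.Ico (G a + (i : ℝ)) (G a + i + 1),
        u < |inner ℝ (f t) (w ω)|} := by
    rintro ω ⟨t, ht, hut⟩
    have h1 : 0 ≤ G t - G a := sub_nonneg.2 (hGm ⟨le_rfl, hab⟩ ht ht.1)
    have h2 : G t ≤ G b := hGm ht ⟨hab, le_rfl⟩ ht.2
    simp only [Set.mem_iUnion, Finset.mem_range, Set.mem_ofPred_eq]
    refine ⟨⌊G t - G a⌋₊, ?_, G t, ⟨?_, ?_⟩, by rwa [hfG t ht]⟩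
    · rw [hN, Nat.lt_succ_iff]
      exact Nat.floor_le_floor (by linarith)
    · linarith [Nat.floor_le h1]
    · linarith [Nat.lt_floor_add_one (G t - G a)]
  refine (measure_mono hsub).trans ((measure_biUnion_finset_le _ _).trans ?_)
  refine (Finset.sum_le_sum fun i _ => hw.measure_exists_Ico_lt hσ hΔ hM hu
    (fun t => hbd _ (hT t)) hflip hx hxu _).trans ?_
  rw [Finset.sum_const, Finset.card_range, ← ENNReal.ofReal_nsmul]
  refine ENNReal.ofReal_le_ofReal ?_
  rw [nsmul_eq_mul, hN]
  push_cast
  have := Nat.floor_le (sub_nonneg.2 hGab)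
  have h3 := Real.exp_pos (-x)
  nlinarith

end Chaining

/-! ### Derivatives with respect to arc length -/

section ArcDeriv

variable {E : Type*} [NormedAddCommGroup E] [NormedSpace ℝ E]

/-- Iterated derivatives within `Θ` with respect to arc length, for the density `g`. -/
noncomputable def arcDeriv (Θ : Set ℝ) (g : ℝ → ℝ) (ψ : ℝ → E) : ℕ → ℝ → E
  | 0 => ψ
  | i + 1 => fun x => (√(g x))⁻¹ • derivWithin (arcDeriv Θ g ψ i) Θ x

theorem contDiffOn_arcDeriv {Θ : Set ℝ} (hΘ : UniqueDiffOn ℝ Θ) {g : ℝ → ℝ} {ψ : ℝ → E} {m : ℕ}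
    (hg : ContDiffOn ℝ m g Θ) (hg0 : ∀ x ∈ Θ, 0 < g x) (hψ : ContDiffOn ℝ (m + 1 : ℕ) ψ Θ)
    {i k : ℕ} (hik : i + k ≤ m + 1) : ContDiffOn ℝ k (arcDeriv Θ g ψ i) Θ := by
  induction i generalizing k with
  | zero => exact hψ.of_le (by exact_mod_cast (by omega : k ≤ m + 1))
  | succ i ih =>
    refine ContDiffOn.smul (ContDiffOn.inv ((hg.sqrt fun x hx => (hg0 x hx).ne').of_le
      (by exact_mod_cast (by omega : k ≤ m))) fun x hx => (Real.sqrt_pos.2 (hg0 x hx)).ne') ?_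
    exact (ih (k := k + 1) (by omega)).derivWithin hΘ (by norm_cast)

theorem hasDerivWithinAt_arcDeriv {Θ : Set ℝ} {g : ℝ → ℝ} {ψ : ℝ → E} {i : ℕ} {x : ℝ}
    (hg : 0 < g x) (h : DifferentiableWithinAt ℝ (arcDeriv Θ g ψ i) Θ x) :
    HasDerivWithinAt (arcDeriv Θ g ψ i) (√(g x) • arcDeriv Θ g ψ (i + 1) x) Θ x := by
  have := h.hasDerivWithinAt
  rwa [arcDeriv, smul_inv_smul₀ (Real.sqrt_pos.2 hg).ne']

end ArcDeriv

/-! ### Covariant derivatives of a Gram kernel. -/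

section Covariant

variable {H : Type*} [NormedAddCommGroup H] [InnerProductSpace ℝ H]

/-- Dividing by the power of `√g` before differentiating cancels the weight left by the earlier
steps, so each covariant step differentiates one arc-length derivative and costs one more factor
`√g`. -/
theorem covD_inner {Θ : Set ℝ} (hΘ : UniqueDiffOn ℝ Θ) {g : ℝ → ℝ} (hg : ∀ x ∈ Θ, 0 < g x)
    {ψ : ℝ → H} {m : ℕ} (hψ : ∀ i < m, DifferentiableOn ℝ (arcDeriv Θ g ψ i) Θ)
    {i j : ℕ} (hi : i ≤ m) (hj : j ≤ m) {x y : ℝ} (hx : x ∈ Θ) (hy : y ∈ Θ) :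
    covD Θ g (fun x y => inner ℝ (ψ x) (ψ y)) i j x y =
      √(g x) ^ i * √(g y) ^ j * inner ℝ (arcDeriv Θ g ψ i x) (arcDeriv Θ g ψ j y) := by
  have hs : ∀ x ∈ Θ, √(g x) ≠ 0 := fun x hx => (Real.sqrt_pos.2 (hg x hx)).ne'
  induction i generalizing x with
  | zero =>
    induction j generalizing y with
    | zero => simp [covD, arcDeriv]
    | succ j ih =>
      rw [covD]
      have hcongr : Set.EqOn (fun y' => covD Θ g (fun x y => inner ℝ (ψ x) (ψ y)) 0 j x y' /
          √(g y') ^ j) (fun y' => inner ℝ (ψ x) (arcDeriv Θ g ψ j y')) Θ := by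
        intro y' hy'
        have := hs y' hy'
        simp only [ih (by omega) hy', arcDeriv]
        field_simp
      have hd := (hasDerivWithinAt_const y Θ (ψ x)).inner ℝ
        (hasDerivWithinAt_arcDeriv (hg y hy) (hψ j (by omega) y hy))
      beta_reduce
      rw [derivWithin_congr hcongr (hcongr hy), hd.derivWithin (hΘ y hy)]
      simp only [inner_smul_right, inner_zero_left, add_zero, arcDeriv]
      ring
  | succ i ih =>
    rw [covD]
    have hcongr : Set.EqOn (fun x' => covD Θ g (fun x y => inner ℝ (ψ x) (ψ y)) i j x' y /
        √(g x') ^ i) (fun x' => √(g y) ^ j *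
          inner ℝ (arcDeriv Θ g ψ i x') (arcDeriv Θ g ψ j y)) Θ := by
      intro x' hx'
      have := hs x' hx'
      simp only [ih (by omega) hx']
      field_simp
    have hd := ((hasDerivWithinAt_arcDeriv (hg x hx) (hψ i (by omega) x hx)).inner ℝ
      (hasDerivWithinAt_const x Θ (arcDeriv Θ g ψ j y))).const_mul (√(g y) ^ j)
    beta_reduce
    rw [derivWithin_congr hcongr (hcongr hx), hd.derivWithin (hΘ x hx)]
    simp only [real_inner_smul_left, inner_zero_right, zero_add]
    ring

theorem kernelG_inner {Θ : Set ℝ} {ψ : ℝ → H} {x : ℝ} (hΘ : UniqueDiffWithinAt ℝ Θ x)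
    (hψ : DifferentiableWithinAt ℝ ψ Θ x) :
    kernelG Θ (fun x y => inner ℝ (ψ x) (ψ y)) x = ‖derivWithin ψ Θ x‖ ^ 2 := by
  have h1 : ∀ z, pdy Θ (fun x y => inner ℝ (ψ x) (ψ y)) z x =
      inner ℝ (ψ z) (derivWithin ψ Θ x) := by
    intro z
    have := (hasDerivWithinAt_const x Θ (ψ z)).inner ℝ hψ.hasDerivWithinAt
    rw [pdy, this.derivWithin hΘ]
    simp
  have h2 := hψ.hasDerivWithinAt.inner ℝ (hasDerivWithinAt_const x Θ (derivWithin ψ Θ x))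
  rw [kernelG, pdx]
  simp only [h1]
  rw [h2.derivWithin hΘ]
  simp

variable {Θ : Set ℝ} {φ : ℝ → H}

/-- `derivWithin` is `0` by default where derivatives within `Θ` are not unique, so positivity of
the density excludes such points. -/
theorem RegularDictionary.uniqueDiffOn (h : RegularDictionary Θ φ) : UniqueDiffOn ℝ Θ := by
  intro x hx
  by_contra hu
  have := h.g_pos x hx
  rw [derivWithin_zero_of_not_uniqueDiffWithinAt hu] at this
  simp at this

theorem RegularDictionary.contDiffOn_feature (h : RegularDictionary Θ φ) :
    ContDiffOn ℝ 3 (feature φ) Θ := by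
  have h0 : ∀ x ∈ Θ, φ x ≠ 0 := fun x hx => norm_pos_iff.1 (h.norm_pos x hx)
  exact ((h.smooth.norm ℝ h0).inv fun x hx => (h.norm_pos x hx).ne').smul h.smooth

theorem RegularDictionary.kernelG_eq (h : RegularDictionary Θ φ) {x : ℝ} (hx : x ∈ Θ) :
    kernelG Θ (dictKernel φ) x = ‖derivWithin (feature φ) Θ x‖ ^ 2 :=
  kernelG_inner (h.uniqueDiffOn x hx) (h.contDiffOn_feature.differentiableOn (by norm_num) x hx)

theorem RegularDictionary.kernelG_pos (h : RegularDictionary Θ φ) {x : ℝ} (hx : x ∈ Θ) :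
    0 < kernelG Θ (dictKernel φ) x := by
  rw [h.kernelG_eq hx]; exact h.g_pos x hx

theorem RegularDictionary.contDiffOn_kernelG (h : RegularDictionary Θ φ) :
    ContDiffOn ℝ 2 (kernelG Θ (dictKernel φ)) Θ :=
  ((h.contDiffOn_feature.derivWithin h.uniqueDiffOn (m := 2) (by norm_num)).norm_sq ℝ).congr
    fun _ hx => h.kernelG_eq hx

/-- The arc-length derivatives of the normalized feature, for its own metric. -/
noncomputable def featureDeriv (Θ : Set ℝ) (φ : ℝ → H) (i : ℕ) : ℝ → H :=
  arcDeriv Θ (kernelG Θ (dictKernel φ)) (feature φ) i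

theorem RegularDictionary.differentiableOn_featureDeriv (h : RegularDictionary Θ φ) {i : ℕ}
    (hi : i < 3) : DifferentiableOn ℝ (featureDeriv Θ φ i) Θ :=
  (contDiffOn_arcDeriv h.uniqueDiffOn (m := 2) h.contDiffOn_kernelG (fun _ => h.kernelG_pos)
    h.contDiffOn_feature (k := 1) (by omega)).differentiableOn (by norm_num)

theorem RegularDictionary.hasDerivWithinAt_featureDeriv (h : RegularDictionary Θ φ) {i : ℕ}
    (hi : i < 3) {x : ℝ} (hx : x ∈ Θ) : HasDerivWithinAt (featureDeriv Θ φ i)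
      (√(kernelG Θ (dictKernel φ) x) • featureDeriv Θ φ (i + 1) x) Θ x :=
  hasDerivWithinAt_arcDeriv (h.kernelG_pos hx) (h.differentiableOn_featureDeriv hi x hx)

theorem RegularDictionary.kernelCov_eq (h : RegularDictionary Θ φ) {i j : ℕ} (hi : i ≤ 3)
    (hj : j ≤ 3) {x y : ℝ} (hx : x ∈ Θ) (hy : y ∈ Θ) :
    kernelCov Θ (dictKernel φ) i j x y =
      inner ℝ (featureDeriv Θ φ i x) (featureDeriv Θ φ j y) := by
  have h1 := Real.sqrt_pos.2 (h.kernelG_pos hx)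
  have h2 := Real.sqrt_pos.2 (h.kernelG_pos hy)
  have := covD_inner h.uniqueDiffOn (fun _ => h.kernelG_pos)
    (fun i hi => h.differentiableOn_featureDeriv hi) hi hj hx hy
  rw [kernelCov, div_eq_iff (by positivity)]
  refine this.trans ?_
  rw [featureDeriv, featureDeriv]
  ring

theorem RegularDictionary.norm_featureDeriv_zero (h : RegularDictionary Θ φ) {x : ℝ}
    (hx : x ∈ Θ) : ‖featureDeriv Θ φ 0 x‖ = 1 := by
  have := h.norm_pos x hx
  rw [featureDeriv, arcDeriv, feature, norm_smul, norm_inv, norm_norm, inv_mul_cancel₀ this.ne']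

theorem RegularDictionary.norm_featureDeriv_one (h : RegularDictionary Θ φ) {x : ℝ}
    (hx : x ∈ Θ) : ‖featureDeriv Θ φ 1 x‖ = 1 := by
  have h1 := h.g_pos x hx
  have h2 : ‖derivWithin (feature φ) Θ x‖ ≠ 0 := fun h0 => by simp [h0] at h1
  rw [featureDeriv, arcDeriv]
  beta_reduce
  rw [h.kernelG_eq hx, Real.sqrt_sq (norm_nonneg _), norm_smul, norm_inv,
    norm_norm]
  exact inv_mul_cancel₀ h2

end Covariant

/-! ### Taylor bounds in arc length -/

section Taylor

variable {E : Type*} [NormedAddCommGroup E] [NormedSpace ℝ E] {a b : ℝ} {ρ G : ℝ → ℝ}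

theorem monotoneOn_of_hasDerivWithinAt_Icc {h h' : ℝ → ℝ}
    (hd : ∀ x ∈ Set.Icc a b, HasDerivWithinAt h (h' x) (Set.Icc a b) x)
    (hn : ∀ x ∈ Set.Icc a b, 0 ≤ h' x) : MonotoneOn h (Set.Icc a b) :=
  monotoneOn_of_hasDerivWithinAt_nonneg (convex_Icc a b)
    (fun x hx => (hd x hx).continuousWithinAt)
    (fun x hx => (hd x (interior_subset hx)).mono interior_subset)
    fun x hx => hn x (interior_subset hx)

theorem le_of_hasDerivWithinAt_of_sign {h h' : ℝ → ℝ}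
    (hd : ∀ x ∈ Set.Icc a b, HasDerivWithinAt h (h' x) (Set.Icc a b) x) {t : ℝ}
    (ht : t ∈ Set.Icc a b) (hr : ∀ x ∈ Set.Icc a b, t ≤ x → 0 ≤ h' x)
    (hl : ∀ x ∈ Set.Icc a b, x ≤ t → h' x ≤ 0) {s : ℝ} (hs : s ∈ Set.Icc a b) : h t ≤ h s := by
  rcases le_total t s with hts | hst
  · have hsub : Set.Icc t b ⊆ Set.Icc a b := Set.Icc_subset_Icc_left ht.1
    exact monotoneOn_of_hasDerivWithinAt_Icc (h := h) (h' := h')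
      (fun x hx => (hd x (hsub hx)).mono hsub) (fun x hx => hr x (hsub hx) hx.1)
      ⟨le_rfl, ht.2⟩ ⟨hts, hs.2⟩ hts
  · have hsub : Set.Icc a t ⊆ Set.Icc a b := Set.Icc_subset_Icc_right ht.2
    have := monotoneOn_of_hasDerivWithinAt_Icc (h := fun x => -h x) (h' := fun x => -h' x)
      (fun x hx => ((hd x (hsub hx)).mono hsub).fun_neg)
      (fun x hx => neg_nonneg.2 (hl x (hsub hx) hx.2)) ⟨hs.1, hst⟩ ⟨ht.1, le_rfl⟩ hst
    exact neg_le_neg_iff.1 this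

/-- Mean value inequality with `M * G` as the majorant, which avoids inverting the arc length. -/
theorem norm_sub_le_of_arc_deriv_le
    (hG : ∀ x ∈ Set.Icc a b, HasDerivWithinAt G (ρ x) (Set.Icc a b) x)
    (hρ : ∀ x ∈ Set.Icc a b, 0 ≤ ρ x) {f f' : ℝ → E}
    (hf : ∀ x ∈ Set.Icc a b, HasDerivWithinAt f (ρ x • f' x) (Set.Icc a b) x) {M : ℝ}
    (hM : ∀ x ∈ Set.Icc a b, ‖f' x‖ ≤ M) {s t : ℝ} (hs : s ∈ Set.Icc a b)
    (ht : t ∈ Set.Icc a b) : ‖f s - f t‖ ≤ M * |G s - G t| := by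
  wlog hts : t ≤ s generalizing s t
  · rw [norm_sub_rev, abs_sub_comm]
    exact this ht hs (le_of_not_ge hts)
  have hGm := monotoneOn_of_hasDerivWithinAt_Icc hG hρ
  rw [abs_of_nonneg (sub_nonneg.2 (hGm ht hs hts))]
  have hsub : Set.Icc t s ⊆ Set.Icc a b := Set.Icc_subset_Icc ht.1 hs.2
  have hright : ∀ x ∈ Set.Ico t s, Set.Icc a b ∈ nhdsWithin x (Set.Ici x) := fun x hx =>
    Filter.mem_of_superset (Icc_mem_nhdsGE (hx.2.trans_le hs.2))
      (Set.Icc_subset_Icc_left (ht.1.trans hx.1))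
  refine image_norm_le_of_norm_deriv_right_le_deriv_boundary' (f := fun x => f x - f t)
    (B := fun x => M * (G x - G t)) (f' := fun x => ρ x • f' x) (B' := fun x => M * ρ x)
    ?_ ?_ ?_ ?_ ?_ ?_ (x := s) ⟨hts, le_rfl⟩
  · exact fun x hx => ((hf x (hsub hx)).sub_const _).continuousWithinAt.mono hsub
  · exact fun x hx => ((hf x (hsub (Set.Ico_subset_Icc_self hx))).sub_const
      _).mono_of_mem_nhdsWithin (hright x hx)
  · simp
  · exact fun x hx => (((hG x (hsub hx)).sub_const _).const_mul M).continuousWithinAt.mono hsub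
  · exact fun x hx => (((hG x (hsub (Set.Ico_subset_Icc_self hx))).sub_const
      _).const_mul M).mono_of_mem_nhdsWithin (hright x hx)
  · intro x hx
    have hx' := hsub (Set.Ico_subset_Icc_self hx)
    rw [norm_smul, Real.norm_of_nonneg (hρ x hx'), mul_comm]
    exact mul_le_mul_of_nonneg_right (hM x hx') (hρ x hx')

theorem abs_taylor_arc_le (hG : ∀ x ∈ Set.Icc a b, HasDerivWithinAt G (ρ x) (Set.Icc a b) x)
    (hρ : ∀ x ∈ Set.Icc a b, 0 ≤ ρ x) {F F₁ F₂ : ℝ → ℝ}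
    (hF : ∀ x ∈ Set.Icc a b, HasDerivWithinAt F (ρ x * F₁ x) (Set.Icc a b) x)
    (hF₁ : ∀ x ∈ Set.Icc a b, HasDerivWithinAt F₁ (ρ x * F₂ x) (Set.Icc a b) x) {M : ℝ}
    (hM : ∀ x ∈ Set.Icc a b, |F₂ x| ≤ M) {s t : ℝ} (hs : s ∈ Set.Icc a b)
    (ht : t ∈ Set.Icc a b) :
    |F s - F t - (G s - G t) * F₁ t| ≤ M / 2 * (G s - G t) ^ 2 := by
  have hGm := monotoneOn_of_hasDerivWithinAt_Icc hG hρ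
  have hlip : ∀ x ∈ Set.Icc a b, |F₁ x - F₁ t| ≤ M * |G x - G t| := fun x hx =>
    norm_sub_le_of_arc_deriv_le hG hρ (f := F₁) (f' := F₂) hF₁ hM hx ht
  -- For either sign, the derivative of the right side is nonpositive before `t` and nonnegative
  -- after it, by the Lipschitz bound on `F₁`; the minimum is thus attained at `t`, where the value
  -- is `0`.
  have key : ∀ ε : ℝ, |ε| = 1 →
      0 ≤ M / 2 * (G s - G t) ^ 2 + ε * (F s - F t - (G s - G t) * F₁ t) := by
    intro ε hε
    have hd : ∀ x ∈ Set.Icc a b, HasDerivWithinAt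
        (fun x => M / 2 * (G x - G t) ^ 2 + ε * (F x - F t - (G x - G t) * F₁ t))
        (ρ x * (M * (G x - G t) + ε * (F₁ x - F₁ t))) (Set.Icc a b) x := by
      intro x hx
      have h1 := ((((hG x hx).sub_const (G t)).fun_pow 2).const_mul (M / 2)).fun_add
        ((((hF x hx).sub_const (F t)).fun_sub
          (((hG x hx).sub_const (G t)).mul_const (F₁ t))).const_mul ε)
      refine h1.congr_deriv ?_
      norm_num
      ring
    have hb : ∀ x ∈ Set.Icc a b, |ε * (F₁ x - F₁ t)| ≤ M * |G x - G t| := fun x hx => by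
      rw [abs_mul, hε, one_mul]; exact hlip x hx
    have := le_of_hasDerivWithinAt_of_sign hd ht (fun x hx htx => ?_) (fun x hx htx => ?_) hs
    · simpa using this
    · have h1 := hb x hx
      rw [abs_of_nonneg (sub_nonneg.2 (hGm ht hx htx))] at h1
      exact mul_nonneg (hρ x hx) (by linarith [neg_le_of_abs_le h1])
    · have h1 := hb x hx
      rw [abs_of_nonpos (sub_nonpos.2 (hGm hx ht htx))] at h1
      exact mul_nonpos_of_nonneg_of_nonpos (hρ x hx) (by linarith [le_of_abs_le h1])
  have h1 := key 1 (by simp)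
  have h2 := key (-1) (by simp)
  exact abs_le.2 ⟨by linarith, by linarith⟩

theorem hasDerivWithinAt_primitive_Icc (hρ : ContinuousOn ρ (Set.Icc a b)) {x : ℝ}
    (hx : x ∈ Set.Icc a b) :
    HasDerivWithinAt (fun u => ∫ t in a..u, ρ t) (ρ x) (Set.Icc a b) x := by
  have hab := hx.1.trans hx.2
  -- Provides the filter instance for the fundamental theorem of calculus within `Icc a b`, end
  -- points included.
  have := Fact.mk hx
  exact intervalIntegral.integral_hasDerivWithinAt_right
    ((hρ.mono (by rw [Set.uIcc_of_le hx.1]; exact Set.Icc_subset_Icc_right hx.2)).intervalIntegrable)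
    (hρ.stronglyMeasurableAtFilter_nhdsWithin measurableSet_Icc x) (hρ x hx)

end Taylor

/-! ### Deterministic analysis of the estimator -/

section Fibers

variable {ι κ : Type*} [Fintype ι] [Fintype κ] [DecidableEq κ]

theorem sum_mul_sum_fiber_some (c : ι → Option κ) (A : κ → ℝ) (f : ι → ℝ) :
    ∑ k, A k * ∑ l with c l = some k, f l = ∑ l, f l * (c l).elim 0 A := by
  simp_rw [Finset.sum_filter, Finset.mul_sum]
  rw [Finset.sum_comm]
  refine Finset.sum_congr rfl fun l _ => ?_
  cases h : c l with
  | none => simp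
  | some k => simp [mul_comm]

/-- Comparison of two discrete signed measures on a function that is expanded to first order
around the atoms of the second one. -/
theorem abs_sum_sub_sum_sub_le (c : ι → Option κ) (β F δ e : ι → ℝ) (γ A B : κ → ℝ) {m M : ℝ}
    (h : ∀ l, |F l - (c l).elim 0 A - δ l * (c l).elim 0 B| ≤ m * δ l ^ 2 + M * e l) :
    |(∑ l, β l * F l - ∑ k, γ k * A k) - ∑ k, A k * ((∑ l with c l = some k, β l) - γ k) -
      ∑ k, B k * ∑ l with c l = some k, β l * δ l| ≤
      m * ∑ l, |β l| * δ l ^ 2 + M * ∑ l, |β l| * e l := by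
  -- After regrouping by fibers only the first-order remainders at the attached atoms are left,
  -- weighted by `β`.
  have e1 : (∑ l, β l * F l - ∑ k, γ k * A k) - ∑ k, A k * ((∑ l with c l = some k, β l) - γ k) -
      ∑ k, B k * ∑ l with c l = some k, β l * δ l =
      ∑ l, β l * (F l - (c l).elim 0 A - δ l * (c l).elim 0 B) := by
    simp_rw [mul_sub, Finset.sum_sub_distrib, sum_mul_sum_fiber_some]
    have : ∑ k, A k * γ k = ∑ k, γ k * A k := Finset.sum_congr rfl fun _ _ => mul_comm _ _
    rw [this]
    simp_rw [mul_assoc]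
    ring
  rw [e1, Finset.mul_sum, Finset.mul_sum, ← Finset.sum_add_distrib]
  refine (Finset.abs_sum_le_sum_abs _ _).trans (Finset.sum_le_sum fun l _ => ?_)
  rw [abs_mul]
  nlinarith [mul_le_mul_of_nonneg_left (h l) (abs_nonneg (β l))]

end Fibers

theorem exists_sign (x : ℝ) : ∃ v : ℝ, (v = 1 ∨ v = -1) ∧ v * x = |x| := by
  rcases le_total 0 x with h | h
  · exact ⟨1, Or.inl rfl, by rw [one_mul, abs_of_nonneg h]⟩
  · exact ⟨-1, Or.inr rfl, by rw [abs_of_nonpos h]; ring⟩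

/-- The numerical core of the risk bounds. -/
theorem risk_bounds_of_inequalities {CN CN' CF CB cN cF cB ε κ R I0 I1 I2 I3 W L t : ℝ}
    (hκ : 0 < κ) (hCB : 0 < CB) (hcB : 0 < cB) (hε : 0 < ε)
    (hR : 0 ≤ R) (hI2 : 0 ≤ I2) (hI3 : 0 ≤ I3) (ht : 0 ≤ t)
    (hε1 : ε * (CN' + cN + 1 / 2) ≤ CN / 2) (hε2 : ε * (2 + cF) ≤ CF / 2)
    (hCN : 0 < CN) (hCF : 0 < CF)
    (hopt : 1 / 2 * R ^ 2 ≤ W - κ * L)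
    (hL : CN * I2 + CF * I3 - CB * t * R ≤ L)
    (h0 : I0 ≤ CB * t * R + CN' * I2 + I3)
    (h1 : I1 ≤ cB * t * R + cN * I2 + cF * I3)
    (hW : W ≤ ε * κ * (I0 + I1 + 1 / 2 * I2 + I3)) :
    R ≤ 2 * (CB + ε * (CB + cB)) * t * κ ∧ |L| ≤ 4 * (CB + ε * (CB + cB)) ^ 2 * κ * t ^ 2 := by
  set D := CB + ε * (CB + cB) with hD
  have hD0 : 0 < D := by positivity
  have hDB : CB ≤ D := by rw [hD]; nlinarith [mul_pos hε (add_pos hCB hcB)]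
  have htR : 0 ≤ t * R := by positivity
  -- The conditions on `ε` let the noise use at most half of the certificate gain `CN * I2 + CF *
  -- I3`.
  have hW' : W ≤ κ * (ε * (CB + cB) * (t * R) + (CN / 2 * I2 + CF / 2 * I3)) := by
    refine hW.trans ?_
    rw [mul_comm ε κ, mul_assoc]
    refine mul_le_mul_of_nonneg_left ?_ hκ.le
    have := mul_le_mul_of_nonneg_left (add_le_add h0 h1) hε.le
    have := mul_le_mul_of_nonneg_right hε1 hI2
    have := mul_le_mul_of_nonneg_right hε2 hI3
    linarith
  have hL' := mul_le_mul_of_nonneg_left hL hκ.le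
  have hmain : 1 / 2 * R ^ 2 + κ * (CN / 2 * I2 + CF / 2 * I3) ≤ κ * (D * (t * R)) := by
    rw [hD]; linarith
  have hJ : 0 ≤ CN / 2 * I2 + CF / 2 * I3 := by positivity
  have hRb : R ≤ 2 * D * t * κ := by
    rcases hR.eq_or_lt with h | h
    · rw [← h]; positivity
    · have : R * R ≤ (2 * D * t * κ) * R := by linarith [mul_nonneg hκ.le hJ]
      exact le_of_mul_le_mul_right this h
  -- The same inequality, now with the square dropped, controls the remaining half of the gain.
  have hJb : CN / 2 * I2 + CF / 2 * I3 ≤ D * (t * R) := by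
    refine le_of_mul_le_mul_left (a := κ) ?_ hκ
    linarith [sq_nonneg R]
  have hDR : D * (t * R) ≤ 2 * D ^ 2 * κ * t ^ 2 := by
    have := mul_le_mul_of_nonneg_left hRb (mul_nonneg hD0.le ht)
    linarith
  have hnn : 0 ≤ 2 * D ^ 2 * κ * t ^ 2 := by positivity
  refine ⟨hRb, abs_le.2 ⟨?_, ?_⟩⟩
  · have : CB * (t * R) ≤ D * (t * R) := mul_le_mul_of_nonneg_right hDB htR
    have := mul_nonneg hCN.le hI2
    have := mul_nonneg hCF.le hI3
    linarith
  -- The upper bound on `L` comes from optimality, `κ * L ≤ W`; the lower one came from the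
  -- certificate.
  · have h3 : κ * L ≤ κ * (ε * (CB + cB) * (t * R) + (CN / 2 * I2 + CF / 2 * I3)) := by
      linarith [sq_nonneg R]
    have h4 := le_of_mul_le_mul_left h3 hκ
    have h5 : ε * (CB + cB) * (t * R) ≤ D * (t * R) :=
      mul_le_mul_of_nonneg_right (by rw [hD]; linarith) htR
    linarith

section Deterministic

variable {H : Type*} [NormedAddCommGroup H] [InnerProductSpace ℝ H] {Θ : Set ℝ} {φ : ℝ → H}

theorem inner_mixture {n : ℕ} (β ϑ : Fin n → ℝ) (z : H) :
    inner ℝ (mixture φ β ϑ) z = ∑ k, β k * inner ℝ (feature φ (ϑ k)) z := by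
  simp_rw [mixture, sum_inner, real_inner_smul_left]

theorem dictDist_comm (x y : ℝ) : dictDist Θ φ x y = dictDist Θ φ y x := by
  rw [dictDist, dictDist, kernelDist, kernelDist, intervalIntegral.integral_symm, abs_neg]

theorem dictDist_self (x : ℝ) : dictDist Θ φ x x = 0 := by
  simp [dictDist, kernelDist]

theorem sign_mul_dictDist_sq (x y : ℝ) :
    (Real.sign (x - y) * dictDist Θ φ x y) ^ 2 = dictDist Θ φ y x ^ 2 := by
  rw [mul_pow, dictDist_comm y x]
  rcases lt_trichotomy x y with h | h | h
  · rw [Real.sign_of_neg (sub_neg.2 h)]; norm_num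
  · rw [h, dictDist_self]; norm_num
  · rw [Real.sign_of_pos (sub_pos.2 h)]; norm_num

theorem half_norm_sq_le_of_criterion_le {n : ℕ} {w : H} {κ : ℝ} {β ϑ γ θ : Fin n → ℝ}
    (h : criterion φ (mixture φ γ θ + w) κ β ϑ ≤ criterion φ (mixture φ γ θ + w) κ γ θ) :
    1 / 2 * ‖mixture φ β ϑ - mixture φ γ θ‖ ^ 2 ≤
      inner ℝ (mixture φ β ϑ - mixture φ γ θ) w - κ * (l1norm β - l1norm γ) := by
  rw [criterion, criterion, add_sub_cancel_left,
    show mixture φ γ θ + w - mixture φ β ϑ = w - (mixture φ β ϑ - mixture φ γ θ) by abel,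
    norm_sub_sq_real, real_inner_comm] at h
  linarith

/-- The risk bounds hold as soon as the noise is small against the dictionary and its expansion. -/
theorem risk_bounds_of_small_noise {B : Set ℝ} {r : ℝ} (hr : 0 < r) {n s : ℕ}
    {γ θ : Fin n → ℝ} (hθ : ∀ k, θ k ∈ B) (hs : s = (vecSupport γ).ncard)
    {CN CN' CF CB cN cF cB ε κ : ℝ}
    (hcert : InterpolatingCertificate Θ B φ r s (θ '' vecSupport γ) CN CN' CF CB)
    (hder : DerivativeCertificate Θ B φ r s (θ '' vecSupport γ) cN cF cB)
    (hκ : 0 < κ) (hCB : 0 < CB) (hcB : 0 < cB) (hε : 0 < ε) (hCN : 0 < CN) (hCF : 0 < CF)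
    (hε1 : ε * (CN' + cN + 1 / 2) ≤ CN / 2) (hε2 : ε * (2 + cF) ≤ CF / 2)
    {w : H} {X₁ : ℝ → ℝ}
    (hX : ∀ x ∈ B, |inner ℝ (feature φ x) w| ≤ ε * κ) (hX₁ : ∀ x ∈ B, |X₁ x| ≤ ε * κ)
    (hexp : ∀ x ∈ B, ∀ t ∈ B, |inner ℝ (feature φ x) w - inner ℝ (feature φ t) w -
      Real.sign (x - t) * dictDist Θ φ x t * X₁ t| ≤ ε * κ / 2 * dictDist Θ φ t x ^ 2)
    {β ϑ : Fin n → ℝ} (hest : IsEstimator B φ (mixture φ γ θ + w) κ β ϑ) :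
    ‖mixture φ β ϑ - mixture φ γ θ‖ ≤ 2 * (CB + ε * (CB + cB)) * √(s : ℝ) * κ ∧
      |l1norm β - l1norm γ| ≤ 4 * (CB + ε * (CB + cB)) ^ 2 * κ * s := by
  -- The image of the support has as many elements as the support, so active atoms are distinct and
  -- signs may be prescribed index by index.
  classical
  have hinj : Set.InjOn θ (vecSupport γ) :=
    Set.injOn_of_ncard_image_eq (by rw [hcert.sep.card, hs]) (Set.toFinite _)
  have hself : ∀ k, θ k ∈ dictBall Θ B φ (θ k) r := fun k =>
    ⟨hθ k, by rw [dictDist_self]; exact hr.le⟩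
  obtain ⟨c, hcnone, hcsome⟩ : ∃ c : Fin n → Option (Fin n),
      (∀ l, c l = none → ∀ q ∈ θ '' vecSupport γ, ϑ l ∉ dictBall Θ B φ q r) ∧
      (∀ l k, c l = some k → γ k ≠ 0 ∧ ϑ l ∈ dictBall Θ B φ (θ k) r) := by
    have : ∀ l, ∃ o : Option (Fin n),
        (o = none → ∀ q ∈ θ '' vecSupport γ, ϑ l ∉ dictBall Θ B φ q r) ∧
        (∀ k, o = some k → γ k ≠ 0 ∧ ϑ l ∈ dictBall Θ B φ (θ k) r) := by
      intro l
      by_cases h : ∃ k, γ k ≠ 0 ∧ ϑ l ∈ dictBall Θ B φ (θ k) r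
      · obtain ⟨k, hk⟩ := h
        refine ⟨some k, by simp, fun k' hk' => ?_⟩
        rwa [← Option.some.inj hk']
      · refine ⟨none, fun _ => ?_, by simp⟩
        rintro q ⟨k, hk, rfl⟩ hq
        exact h ⟨k, hk, hq⟩
    choose c hc using this
    exact ⟨c, fun l => (hc l).1, fun l => (hc l).2⟩
  -- The signed distance is a difference of arc lengths, hence the right variable for first-order
  -- expansions.
  set sd : ℝ → ℝ → ℝ := fun x t => Real.sign (x - t) * dictDist Θ φ x t with hsd
  have hsd2 : ∀ x t, sd x t ^ 2 = dictDist Θ φ t x ^ 2 := sign_mul_dictDist_sq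
  set δ : Fin n → ℝ := fun l => (c l).elim 0 fun k => sd (ϑ l) (θ k) with hδ
  set e : Fin n → ℝ := fun l => (c l).elim 1 fun _ => 0 with he
  have hδsome : ∀ l k, c l = some k → δ l = sd (ϑ l) (θ k) := fun l k h => by simp [hδ, h]
  have hδnone : ∀ l, c l = none → δ l = 0 := fun l h => by simp [hδ, h]
  have hesome : ∀ l k, c l = some k → e l = 0 := fun l k h => by simp [he, h]
  have henone : ∀ l, c l = none → e l = 1 := fun l h => by simp [he, h]
  have he0 : ∀ l, 0 ≤ e l := fun l => by
    cases h : c l with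
    | none => rw [henone l h]; exact zero_le_one
    | some k => rw [hesome l k h]
  -- Mass errors `u` and first moments `b` around the atoms; both vanish off the support of `γ`,
  -- where no certificate is available.
  set u : Fin n → ℝ := fun k => (∑ l with c l = some k, β l) - γ k with hu
  set b : Fin n → ℝ := fun k => ∑ l with c l = some k, β l * δ l with hb
  have hu0 : ∀ k, γ k = 0 → u k = 0 := by
    intro k hk
    have : (Finset.univ.filter fun l => c l = some k) = ∅ :=
      Finset.filter_eq_empty_iff.2 fun l _ h => (hcsome l k h).1 hk
    simp only [hu, this, Finset.sum_empty, hk, sub_zero]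
  have hb0 : ∀ k, γ k = 0 → b k = 0 := by
    intro k hk
    have : (Finset.univ.filter fun l => c l = some k) = ∅ :=
      Finset.filter_eq_empty_iff.2 fun l _ h => (hcsome l k h).1 hk
    simp only [hb, this, Finset.sum_empty]
  set h := mixture φ β ϑ - mixture φ γ θ with hh
  have hinner : ∀ z : H, inner ℝ h z = ∑ l, β l * inner ℝ (feature φ (ϑ l)) z -
      ∑ k, γ k * inner ℝ (feature φ (θ k)) z := fun z => by
    rw [hh, inner_sub_left, inner_mixture, inner_mixture]
  set I2 := ∑ l, |β l| * δ l ^ 2 with hI2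
  set I3 := ∑ l, |β l| * e l with hI3
  have hI2n : 0 ≤ I2 := Finset.sum_nonneg fun l _ => by positivity
  have hI3n : 0 ≤ I3 := Finset.sum_nonneg fun l _ => mul_nonneg (abs_nonneg _) (he0 l)
  -- a choice of signs on the indices induces one on the atoms
  have hsigns : ∀ x : Fin n → ℝ, ∃ v : ℝ → ℝ, (∀ q ∈ θ '' vecSupport γ, v q = 1 ∨ v q = -1) ∧
      ∀ k, γ k ≠ 0 → v (θ k) * x k = |x k| := by
    intro x
    choose g hg1 hg2 using fun k => exists_sign (x k)
    refine ⟨fun q => if hq : ∃ k, γ k ≠ 0 ∧ θ k = q then g hq.choose else 1, ?_, ?_⟩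
    · rintro q -
      by_cases hq : ∃ k, γ k ≠ 0 ∧ θ k = q
      · simp only [hq, dite_true]; exact hg1 _
      · simp [hq]
    · intro k hk
      have hq : ∃ k', γ k' ≠ 0 ∧ θ k' = θ k := ⟨k, hk, rfl⟩
      have : hq.choose = k := hinj hq.choose_spec.1 hk hq.choose_spec.2
      simp only [hq, dite_true, this]
      exact hg2 k
  have hin : ∀ z : H, ∀ C : ℝ, ‖z‖ ≤ C * √(s : ℝ) → |inner ℝ h z| ≤ C * √(s : ℝ) * ‖h‖ := by
    intro z C hz
    refine (abs_real_inner_le_norm h z).trans ?_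
    rw [mul_comm]
    exact mul_le_mul_of_nonneg_right hz (norm_nonneg h)
  have hsq : √(s : ℝ) ^ 2 = s := Real.sq_sqrt (Nat.cast_nonneg s)
  suffices ‖h‖ ≤ 2 * (CB + ε * (CB + cB)) * √(s : ℝ) * κ ∧
      |l1norm β - l1norm γ| ≤ 4 * (CB + ε * (CB + cB)) ^ 2 * κ * √(s : ℝ) ^ 2 by rwa [hsq] at this
  refine risk_bounds_of_inequalities (CN := CN) (CN' := CN') (CF := CF) (cN := cN) (cF := cF)
    (I0 := ∑ k, |u k|) (I1 := ∑ k, |b k|) (I2 := I2) (I3 := I3) (W := inner ℝ h w)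
    hκ hCB hcB hε (norm_nonneg _) hI2n hI3n (Real.sqrt_nonneg _) hε1 hε2 hCN hCF
    (half_norm_sq_le_of_criterion_le (hest.2 γ θ hθ)) ?_ ?_ ?_ ?_
  -- Signs of `γ`: the certificate attains the ℓ₁ norm at the truth and loses at least `CN * I2 + CF
  -- * I3` at the estimator.
  · obtain ⟨v, hv, hvγ⟩ := hsigns γ
    obtain ⟨p, hp1, hp2, hp3, hp4⟩ := hcert.exists_cert v hv
    have h1 : ∑ k, γ k * inner ℝ (feature φ (θ k)) p = l1norm γ := by
      refine Finset.sum_congr rfl fun k _ => ?_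
      by_cases hk : γ k = 0
      · simp [hk]
      · have := hp2 _ ⟨k, hk, rfl⟩ _ (hself k)
        rw [dictDist_self, zero_pow two_ne_zero, mul_zero] at this
        rw [sub_eq_zero.1 (abs_nonpos_iff.1 this), mul_comm]
        exact hvγ k hk
    have h2 : ∑ l, β l * inner ℝ (feature φ (ϑ l)) p ≤ l1norm β - CN * I2 - CF * I3 := by
      rw [l1norm, hI2, hI3, Finset.mul_sum, Finset.mul_sum, ← Finset.sum_sub_distrib,
        ← Finset.sum_sub_distrib]
      refine Finset.sum_le_sum fun l _ => ?_
      have h3 : |inner ℝ (feature φ (ϑ l)) p| ≤ 1 - CN * δ l ^ 2 - CF * e l := by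
        cases hc : c l with
        | none =>
          rw [hδnone l hc, henone l hc]
          have := hp3 (ϑ l) (hest.1 l) (hcnone l hc)
          linarith
        | some k =>
          rw [hδsome l k hc, hesome l k hc, hsd2]
          have := hp1 _ ⟨k, (hcsome l k hc).1, rfl⟩ _ (hcsome l k hc).2
          linarith
      have h4 : β l * inner ℝ (feature φ (ϑ l)) p ≤ |β l| * |inner ℝ (feature φ (ϑ l)) p| := by
        rw [← abs_mul]; exact le_abs_self _
      nlinarith [mul_le_mul_of_nonneg_left h3 (abs_nonneg (β l))]
    have h5 := hinner p
    have h6 := neg_le_of_abs_le (hin p CB hp4)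
    linarith
  -- Signs of `u`: the certificate has value `v` and no first-order term at the atoms, so it
  -- isolates `I0`.
  · obtain ⟨v, hv, hvu⟩ := hsigns u
    obtain ⟨p, hp1, hp2, hp3, hp4⟩ := hcert.exists_cert v hv
    have h1 := abs_sum_sub_sum_sub_le c β (fun l => inner ℝ (feature φ (ϑ l)) p) δ e γ
      (fun k => v (θ k)) (fun _ => 0) (m := CN') (M := 1) fun l => by
        cases hc : c l with
        | none =>
          rw [hδnone l hc, henone l hc]
          have := hp3 (ϑ l) (hest.1 l) (hcnone l hc)
          simp only [Option.elim_none]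
          rw [sub_zero, zero_mul, sub_zero]
          linarith
        | some k =>
          rw [hδsome l k hc, hesome l k hc, hsd2]
          have := hp2 _ ⟨k, (hcsome l k hc).1, rfl⟩ _ (hcsome l k hc).2
          simpa using this
    have h2 : ∑ k, γ k * v (θ k) = ∑ k, γ k * inner ℝ (feature φ (θ k)) p := by
      refine Finset.sum_congr rfl fun k _ => ?_
      by_cases hk : γ k = 0
      · simp [hk]
      · have := hp2 _ ⟨k, hk, rfl⟩ _ (hself k)
        rw [dictDist_self, zero_pow two_ne_zero, mul_zero] at this
        rw [sub_eq_zero.1 (abs_nonpos_iff.1 this)]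
    have h3 : ∑ k, v (θ k) * u k = ∑ k, |u k| := by
      refine Finset.sum_congr rfl fun k _ => ?_
      by_cases hk : γ k = 0
      · simp [hu0 k hk]
      · exact hvu k hk
    rw [h2, ← hinner p] at h1
    simp only [zero_mul, Finset.sum_const_zero, sub_zero] at h1
    rw [h3] at h1
    have h5 := neg_le_of_abs_le h1
    have h6 := le_of_abs_le (hin p CB hp4)
    linarith
  -- Signs of `b`: the derivative certificate vanishes at the atoms with slope `v`, so it isolates
  -- `I1`.
  · obtain ⟨v, hv, hvb⟩ := hsigns b
    obtain ⟨q, hq1, hq2, hq3⟩ := hder.exists_cert v hv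
    have h1 := abs_sum_sub_sum_sub_le c β (fun l => inner ℝ (feature φ (ϑ l)) q) δ e γ
      (fun _ => 0) (fun k => v (θ k)) (m := cN) (M := cF) fun l => by
        cases hc : c l with
        | none =>
          rw [hδnone l hc, henone l hc]
          have := hq2 (ϑ l) (hest.1 l) (hcnone l hc)
          simp only [Option.elim_none]
          rw [sub_zero, zero_mul, sub_zero]
          linarith
        | some k =>
          rw [hδsome l k hc, hesome l k hc, hsd2]
          have := hq1 _ ⟨k, (hcsome l k hc).1, rfl⟩ _ (hcsome l k hc).2
          simp only [Option.elim_some, hsd]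
          rw [sub_zero, mul_comm (_ * _) (v _), ← mul_assoc]
          linarith
    have h2 : ∑ k, γ k * 0 = ∑ k, γ k * inner ℝ (feature φ (θ k)) q := by
      refine Finset.sum_congr rfl fun k _ => ?_
      by_cases hk : γ k = 0
      · simp [hk]
      · have := hq1 _ ⟨k, hk, rfl⟩ _ (hself k)
        rw [dictDist_self, zero_pow two_ne_zero, mul_zero, mul_zero, sub_zero] at this
        rw [abs_nonpos_iff.1 this]
    have h3 : ∑ k, v (θ k) * b k = ∑ k, |b k| := by
      refine Finset.sum_congr rfl fun k _ => ?_
      by_cases hk : γ k = 0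
      · simp [hb0 k hk]
      · exact hvb k hk
    rw [h2, ← hinner q] at h1
    simp only [zero_mul, Finset.sum_const_zero, sub_zero] at h1
    rw [h3] at h1
    have h5 := neg_le_of_abs_le h1
    have h6 := le_of_abs_le (hin q cB hq3)
    linarith
  -- The noise itself as test function, with values and slopes at the atoms bounded by `ε * κ`.
  · have h1 := abs_sum_sub_sum_sub_le c β (fun l => inner ℝ (feature φ (ϑ l)) w) δ e γ
      (fun k => inner ℝ (feature φ (θ k)) w) (fun k => X₁ (θ k)) (m := ε * κ / 2)
      (M := ε * κ) fun l => by
        cases hc : c l with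
        | none =>
          rw [hδnone l hc, henone l hc]
          have := hX (ϑ l) (hest.1 l)
          simp only [Option.elim_none]
          rw [sub_zero, zero_mul, sub_zero]
          linarith
        | some k =>
          rw [hδsome l k hc, hesome l k hc, hsd2]
          have := hexp _ (hest.1 l) _ (hθ k)
          simp only [Option.elim_some, hsd]
          linarith
    rw [← hinner w] at h1
    have hsum : ∀ x A : Fin n → ℝ, (∀ k, |A k| ≤ ε * κ) →
        ∑ k, A k * x k ≤ ε * κ * ∑ k, |x k| := by
      intro x A hA
      rw [Finset.mul_sum]
      refine Finset.sum_le_sum fun k _ => (le_abs_self _).trans ?_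
      rw [abs_mul]
      exact mul_le_mul_of_nonneg_right (hA k) (abs_nonneg _)
    have h2 := hsum u _ fun k => hX _ (hθ k)
    have h3 := hsum b _ fun k => hX₁ _ (hθ k)
    have h4 := le_of_abs_le h1
    linarith

end Deterministic

/-! ### Consequences of the proximity to the limit kernel -/

section Proximity

variable {H : Type*} [NormedAddCommGroup H] [InnerProductSpace ℝ H] {Θ S B : Set ℝ}
  {K : ℝ → ℝ → ℝ} {φ : ℝ → H}

/-- The allowed deviation is itself at most `L_{2,2}`, whence the factor two. -/
theorem CloseToLimit.abs_kernelCov_le {KT : ℝ → ℝ → ℝ} (h : CloseToLimit Θ S B KT K) {m : ℝ}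
    (hm : kernelL Θ S K 2 2 ≤ (m : EReal)) {x : ℝ} (hx : x ∈ B) :
    |kernelCov Θ KT 2 2 x x| ≤ 2 * m := by
  have h1 : ((|kernelCov Θ K 2 2 x x| : ℝ) : EReal) ≤ m := by
    refine le_trans ?_ hm
    rw [kernelL]
    exact le_iSup₂_of_le x (h.subset hx) (le_iSup₂_of_le x (h.subset hx) le_rfl)
  have h2 : ((|kernelCov Θ KT 2 2 x x - kernelCov Θ K 2 2 x x| : ℝ) : EReal) ≤ m := by
    refine le_trans ?_ (((le_max_left _ _).trans h.close).trans ((min_le_left _ _).trans hm))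
    exact le_iSup₂_of_le 2 (Set.mem_Iic.2 le_rfl) (le_iSup₂_of_le 2 (Set.mem_Iic.2 le_rfl)
      (le_iSup₂_of_le x hx (le_iSup₂_of_le x hx le_rfl)))
  rw [EReal.coe_le_coe_iff] at h1 h2
  have := abs_sub_abs_le_abs_sub (kernelCov Θ KT 2 2 x x) (kernelCov Θ K 2 2 x x)
  linarith

theorem CloseToLimit.kernelH_le {KT : ℝ → ℝ → ℝ} (h : CloseToLimit Θ S B KT K) {m : ℝ}
    (hm : kernelL3 Θ S K ≤ (m : EReal)) {x : ℝ} (hx : x ∈ B) : kernelH Θ KT x ≤ 2 * m := by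
  have h1 : ((kernelH Θ K x : ℝ) : EReal) ≤ m :=
    le_trans (le_iSup₂_of_le x (h.subset hx) le_rfl) hm
  have h2 : ((|kernelH Θ KT x - kernelH Θ K x| : ℝ) : EReal) ≤ m := by
    refine le_trans ?_ (((le_max_right _ _).trans h.close).trans ((min_le_right _ _).trans hm))
    exact le_iSup₂_of_le x hx le_rfl
  rw [EReal.coe_le_coe_iff] at h1 h2
  linarith [le_of_abs_le h2]

/-- The arc-length derivatives of the feature up to order three are bounded on `B` by a constant
that depends on the limit kernel only. -/
theorem LimitKernel.exists_norm_featureDeriv_le (hK : LimitKernel Θ S K) :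
    ∃ M : ℝ, 1 ≤ M ∧ ∀ (H : Type*) [NormedAddCommGroup H] [InnerProductSpace ℝ H] (φ : ℝ → H)
      (B : Set ℝ), RegularDictionary Θ φ → CloseToLimit Θ S B (dictKernel φ) K →
      ∀ i ≤ 3, ∀ x ∈ B, ‖featureDeriv Θ φ i x‖ ≤ M := by
  have h2 := EReal.le_coe_toReal (hK.L_lt_top 2 le_rfl 2 le_rfl).ne
  have h3 := EReal.le_coe_toReal hK.L3_lt_top.ne
  set m₂ := (kernelL Θ S K 2 2).toReal
  set m₃ := (kernelL3 Θ S K).toReal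
  refine ⟨1 + 2 * |m₂| + 2 * |m₃|, by linarith [abs_nonneg m₂, abs_nonneg m₃], ?_⟩
  intro H _ _ φ B hφ hB i hi x hx
  have hxΘ : x ∈ Θ := hK.subset (hB.subset hx)
  have p2 := abs_nonneg m₂
  have p3 := abs_nonneg m₃
  have hsq : ∀ y : ℝ, y ^ 2 ≤ 2 * |m₂| + 2 * |m₃| → y ≤ 1 + 2 * |m₂| + 2 * |m₃| := by
    intro y hy
    nlinarith [sq_nonneg (y - 1)]
  -- Orders zero and one have norm one, by normalization and by arc length. The squared norms at
  -- orders two and three are the diagonal values of `K^{[2,2]}` and `K^{[3,3]}`.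
  interval_cases i
  · rw [hφ.norm_featureDeriv_zero hxΘ]; linarith
  · rw [hφ.norm_featureDeriv_one hxΘ]; linarith
  · refine hsq _ ?_
    have h := le_of_abs_le (hB.abs_kernelCov_le h2 hx)
    rw [hφ.kernelCov_eq (by norm_num) (by norm_num) hxΘ hxΘ, real_inner_self_eq_norm_sq] at h
    linarith [le_abs_self m₂]
  · refine hsq _ ?_
    have h := hB.kernelH_le h3 hx
    rw [kernelH, hφ.kernelCov_eq le_rfl le_rfl hxΘ hxΘ, real_inner_self_eq_norm_sq] at h
    linarith [le_abs_self m₃]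

end Proximity

/-! ### Arc length of a regular dictionary on a compact interval -/

section ArcLength

variable {H : Type*} [NormedAddCommGroup H] [InnerProductSpace ℝ H] {Θ : Set ℝ} {φ : ℝ → H}
  {a b : ℝ}

theorem RegularDictionary.continuousOn_sqrt_kernelG (h : RegularDictionary Θ φ)
    (hab : Set.Icc a b ⊆ Θ) :
    ContinuousOn (fun t => √(kernelG Θ (dictKernel φ) t)) (Set.Icc a b) :=
  (h.contDiffOn_kernelG.continuousOn.mono hab).sqrt

/-- Arc length from `a`. -/
noncomputable def arcLength (Θ : Set ℝ) (φ : ℝ → H) (a x : ℝ) : ℝ :=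
  ∫ t in a..x, √(kernelG Θ (dictKernel φ) t)

theorem RegularDictionary.hasDerivWithinAt_arcLength (h : RegularDictionary Θ φ)
    (hab : Set.Icc a b ⊆ Θ) : ∀ x ∈ Set.Icc a b, HasDerivWithinAt (arcLength Θ φ a)
      (√(kernelG Θ (dictKernel φ) x)) (Set.Icc a b) x :=
  fun _ hx => hasDerivWithinAt_primitive_Icc (h.continuousOn_sqrt_kernelG hab) hx

theorem RegularDictionary.monotoneOn_arcLength (h : RegularDictionary Θ φ)
    (hab : Set.Icc a b ⊆ Θ) : MonotoneOn (arcLength Θ φ a) (Set.Icc a b) :=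
  monotoneOn_of_hasDerivWithinAt_Icc (h.hasDerivWithinAt_arcLength hab) fun _ _ =>
    Real.sqrt_nonneg _

theorem RegularDictionary.dictDist_eq (h : RegularDictionary Θ φ) (hab : Set.Icc a b ⊆ Θ)
    {x y : ℝ} (hx : x ∈ Set.Icc a b) (hy : y ∈ Set.Icc a b) :
    dictDist Θ φ x y = |arcLength Θ φ a x - arcLength Θ φ a y| := by
  have hint : ∀ z ∈ Set.Icc a b,
      IntervalIntegrable (fun t => √(kernelG Θ (dictKernel φ) t)) volume a z := fun z hz =>
    ((h.continuousOn_sqrt_kernelG hab).mono (by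
      rw [Set.uIcc_of_le hz.1]; exact Set.Icc_subset_Icc_right hz.2)).intervalIntegrable
  rw [dictDist, kernelDist, arcLength, arcLength,
    intervalIntegral.integral_interval_sub_left (hint x hx) (hint y hy)]

theorem RegularDictionary.sign_mul_dictDist (h : RegularDictionary Θ φ) (hab : Set.Icc a b ⊆ Θ)
    {x y : ℝ} (hx : x ∈ Set.Icc a b) (hy : y ∈ Set.Icc a b) :
    Real.sign (x - y) * dictDist Θ φ x y = arcLength Θ φ a x - arcLength Θ φ a y := by
  have hm := h.monotoneOn_arcLength hab
  rw [h.dictDist_eq hab hx hy]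
  rcases lt_trichotomy x y with hxy | hxy | hxy
  · rw [Real.sign_of_neg (sub_neg.2 hxy), abs_of_nonpos (sub_nonpos.2 (hm hx hy hxy.le))]
    ring
  · simp [hxy]
  · rw [Real.sign_of_pos (sub_pos.2 hxy), abs_of_nonneg (sub_nonneg.2 (hm hy hx hxy.le)), one_mul]

theorem RegularDictionary.norm_featureDeriv_sub_le (h : RegularDictionary Θ φ)
    (hab : Set.Icc a b ⊆ Θ) {i : ℕ} (hi : i < 3) {M : ℝ}
    (hM : ∀ x ∈ Set.Icc a b, ‖featureDeriv Θ φ (i + 1) x‖ ≤ M) :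
    ∀ s ∈ Set.Icc a b, ∀ t ∈ Set.Icc a b, ‖featureDeriv Θ φ i s - featureDeriv Θ φ i t‖ ≤
      M * |arcLength Θ φ a s - arcLength Θ φ a t| := fun _ hs _ ht =>
  norm_sub_le_of_arc_deriv_le (h.hasDerivWithinAt_arcLength hab) (fun _ _ => Real.sqrt_nonneg _)
    (fun _ hx => (h.hasDerivWithinAt_featureDeriv hi (hab hx)).mono hab) hM hs ht

/-- Second-order expansion of `θ ↦ ⟨φ(θ), w⟩` in arc length. -/
theorem RegularDictionary.abs_inner_feature_sub_le (h : RegularDictionary Θ φ)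
    (hab : Set.Icc a b ⊆ Θ) {w : H} {M : ℝ}
    (hM : ∀ x ∈ Set.Icc a b, |inner ℝ (featureDeriv Θ φ 2 x) w| ≤ M) {x t : ℝ}
    (hx : x ∈ Set.Icc a b) (ht : t ∈ Set.Icc a b) :
    |inner ℝ (feature φ x) w - inner ℝ (feature φ t) w -
      Real.sign (x - t) * dictDist Θ φ x t * inner ℝ (featureDeriv Θ φ 1 t) w| ≤
      M / 2 * dictDist Θ φ t x ^ 2 := by
  rw [dictDist_comm t x, h.sign_mul_dictDist hab hx ht, h.dictDist_eq hab hx ht, sq_abs]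
  have hd : ∀ i < 3, ∀ x ∈ Set.Icc a b, HasDerivWithinAt
      (fun x => inner ℝ (featureDeriv Θ φ i x) w)
      (√(kernelG Θ (dictKernel φ) x) * inner ℝ (featureDeriv Θ φ (i + 1) x) w)
      (Set.Icc a b) x := by
    intro i hi x hx
    refine (((h.hasDerivWithinAt_featureDeriv hi (hab hx)).mono hab).inner ℝ
      (hasDerivWithinAt_const x _ w)).congr_deriv ?_
    rw [inner_zero_right, zero_add, real_inner_smul_left]
  exact abs_taylor_arc_le (h.hasDerivWithinAt_arcLength hab) (fun _ _ => Real.sqrt_nonneg _)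
    (F := fun x => inner ℝ (feature φ x) w) (hd 0 (by norm_num)) (hd 1 (by norm_num)) hM hx ht

end ArcLength

/-! ### The event on which the noise is small. -/

section Event

variable {H : Type*} [NormedAddCommGroup H] [InnerProductSpace ℝ H] {Θ : Set ℝ} {φ : ℝ → H}
  {a b : ℝ} {Ω : Type*} [MeasurableSpace Ω] {P : Measure Ω} [IsProbabilityMeasure P] {w : Ω → H}
  {σ Δ : ℝ}

/-- The projections of the noise on the feature and on its first two arc-length derivatives are
uniformly small with large probability. -/
theorem measure_exists_featureDeriv_lt (h : RegularDictionary Θ φ) (hle : a ≤ b)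
    (hab : Set.Icc a b ⊆ Θ) (hw : AdmissibleNoise P w σ Δ) (hσ : 0 < σ) (hΔ : 0 < Δ) {M u x : ℝ}
    (hM : 0 < M) (hbd : ∀ i ≤ 3, ∀ t ∈ Set.Icc a b, ‖featureDeriv Θ φ i t‖ ≤ M) (hu : 0 ≤ u)
    (hx : 1 ≤ x) (hxu : 32 * (σ ^ 2 * Δ * M ^ 2) * x = u ^ 2) :
    P {ω | ∃ i < 3, ∃ t ∈ Set.Icc a b, u < |inner ℝ (featureDeriv Θ φ i t) (w ω)|} ≤
      ENNReal.ofReal (54 * (dictDist Θ φ a b + 1) * Real.exp (-x)) := by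
  have hG := h.hasDerivWithinAt_arcLength hab
  have hGm := h.monotoneOn_arcLength hab
  have ha : a ∈ Set.Icc a b := ⟨le_rfl, hle⟩
  have hb : b ∈ Set.Icc a b := ⟨hle, le_rfl⟩
  have hd : dictDist Θ φ a b = arcLength Θ φ a b - arcLength Θ φ a a := by
    rw [dictDist_comm, h.dictDist_eq hab hb ha, abs_of_nonneg (sub_nonneg.2 (hGm ha hb hle))]
  have hsub : {ω | ∃ i < 3, ∃ t ∈ Set.Icc a b, u < |inner ℝ (featureDeriv Θ φ i t) (w ω)|} ⊆
      ⋃ i ∈ Finset.range 3,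
        {ω | ∃ t ∈ Set.Icc a b, u < |inner ℝ (featureDeriv Θ φ i t) (w ω)|} := by
    rintro ω ⟨i, hi, hω⟩
    exact Set.mem_biUnion (Finset.mem_coe.2 (Finset.mem_range.2 hi)) hω
  refine (measure_mono hsub).trans ((measure_biUnion_finset_le _ _).trans ?_)
  refine (Finset.sum_le_sum fun i hi => hw.measure_exists_Icc_lt hσ hΔ hle
    (fun x hx => (hG x hx).continuousWithinAt) hGm hM hu (hbd i (Finset.mem_range.1 hi).le)
    (h.norm_featureDeriv_sub_le hab (Finset.mem_range.1 hi)
      (hbd (i + 1) (Finset.mem_range.1 hi))) hx hxu).trans ?_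
  rw [Finset.sum_const, Finset.card_range, ← ENNReal.ofReal_nsmul, ← hd]
  refine ENNReal.ofReal_le_ofReal (le_of_eq ?_)
  rw [nsmul_eq_mul]
  push_cast
  ring

/-- The bad event is an uncountable union, and neither it nor the estimators need be measurable; the
complement of a measurable hull serves as the good event. -/
theorem exists_measurableSet_of_measure_le {s : Set Ω} {p : ℝ} (hp : 0 ≤ p)
    (hs : P s ≤ ENNReal.ofReal p) {Q : Ω → Prop} (hQ : ∀ᵐ ω ∂P, ω ∉ s → Q ω) :
    ∃ A : Set Ω, MeasurableSet A ∧ 1 - p ≤ P.real A ∧ ∀ ω ∈ A, Q ω := by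
  set N : Set Ω := {ω | ¬ (ω ∉ s → Q ω)} with hN
  have hN0 : P N = 0 := ae_iff.1 hQ
  refine ⟨(toMeasurable P (s ∪ N))ᶜ, (measurableSet_toMeasurable _ _).compl, ?_, ?_⟩
  · rw [probReal_compl_eq_one_sub (measurableSet_toMeasurable _ _)]
    have : P.real (toMeasurable P (s ∪ N)) ≤ p := by
      rw [measureReal_def, measure_toMeasurable]
      refine ENNReal.toReal_le_of_le_ofReal hp ((measure_union_le _ _).trans ?_)
      rwa [hN0, add_zero]
    linarith
  · intro ω hω
    have h1 : ω ∉ s ∪ N := fun h => hω (subset_toMeasurable _ _ h)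
    have h2 : ω ∉ N := fun h => h1 (Or.inr h)
    exact not_not.1 h2 fun h => h1 (Or.inl h)

end Event

/-! ### Choice of the constants and conclusion. -/

/-- Here `exp (-x) ≤ τ⁻²`, and one factor `τ` is given up through `√(log τ) ≤ τ` for the length term
and `1 ≤ τ` for the constant term. -/
theorem mul_exp_neg_le_max {d x τ : ℝ} (hd : 0 ≤ d) (hτ : 3 ≤ τ) (hx : 2 * Real.log τ ≤ x) :
    54 * (d + 1) * Real.exp (-x) ≤ 108 * max (d / (τ * √(Real.log τ))) (1 / τ) := by
  have hτ0 : 0 < τ := by linarith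
  have hexp : Real.exp (-x) ≤ 1 / (τ * τ) := by
    calc Real.exp (-x) ≤ Real.exp (-(Real.log τ + Real.log τ)) := Real.exp_le_exp.2 (by linarith)
      _ = _ := by rw [Real.exp_neg, Real.exp_add, Real.exp_log hτ0, one_div]
  have hlog0 : 0 < Real.log τ := Real.log_pos (by linarith)
  have hsqrt : √(Real.log τ) ≤ τ := by
    refine Real.sqrt_le_iff.2 ⟨hτ0.le, ?_⟩
    have := Real.log_le_sub_one_of_pos hτ0
    nlinarith
  have hs0 := Real.sqrt_pos.2 hlog0
  have h1 : d * (1 / (τ * τ)) ≤ d / (τ * √(Real.log τ)) := by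
    rw [mul_one_div]; gcongr
  have h2 : 1 / (τ * τ) ≤ 1 / τ := by
    gcongr; nlinarith
  have h3 := le_max_left (d / (τ * √(Real.log τ))) (1 / τ)
  have h4 := le_max_right (d / (τ * √(Real.log τ))) (1 / τ)
  have h5 : 54 * (d + 1) * Real.exp (-x) ≤ 54 * (d + 1) * (1 / (τ * τ)) := by gcongr
  linarith

theorem theorem1 (Θ Θinf : Set ℝ) (hΘ : Θ.OrdConnected) (Kinf : ℝ → ℝ → ℝ)
    (hK : LimitKernel Θ Θinf Kinf) (r : ℝ) (hr : 0 < r)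
    (CN CN' CF CB cN cF cB : ℝ) (hCN : 0 < CN) (hCN' : 0 < CN') (hCF : 0 < CF) (hCF1 : CF < 1)
    (hCB : 0 < CB) (hcN : 0 < cN) (hcF : 0 < cF) (hcB : 0 < cB) :
    ∃ C0 C1 C2 C3 : ℝ, 0 < C0 ∧ 0 < C1 ∧ 0 < C2 ∧ 0 < C3 ∧
      ∀ (H : Type*) [NormedAddCommGroup H] [InnerProductSpace ℝ H] [CompleteSpace H]
        (φ : ℝ → H) (a b : ℝ),
        RegularDictionary Θ φ →
        CloseToLimit Θ Θinf (Set.Icc a b) (dictKernel φ) Kinf →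
      ∀ (n s : ℕ) (βstar θstar : Fin n → ℝ),
        (∀ k, θstar k ∈ Set.Icc a b) →
        s = (vecSupport βstar).ncard →
        InterpolatingCertificate Θ (Set.Icc a b) φ r s (θstar '' vecSupport βstar)
          CN CN' CF CB →
        DerivativeCertificate Θ (Set.Icc a b) φ r s (θstar '' vecSupport βstar) cN cF cB →
      ∀ (Ω : Type*) [MeasurableSpace Ω] (P : Measure Ω) [IsProbabilityMeasure P]
        (w y : Ω → H) (σ Δ : ℝ), 0 < σ → 0 < Δ →
        AdmissibleNoise P w σ Δ →
        (∀ᵐ ω ∂P, y ω = mixture φ βstar θstar + w ω) →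
      ∀ τ κ : ℝ, 0 < τ → 0 < κ → C1 * σ * √(Δ * Real.log τ) ≤ κ →
      ∀ βhat θhat : Ω → Fin n → ℝ,
        (∀ᵐ ω ∂P, IsEstimator (Set.Icc a b) φ (y ω) κ (βhat ω) (θhat ω)) →
        ∃ A : Set Ω, MeasurableSet A ∧
          1 - C2 * max (dictDist Θ φ a b / (τ * √(Real.log τ))) (1 / τ) ≤ P.real A ∧
          ∀ ω ∈ A,
            ‖mixture φ (βhat ω) (θhat ω) - mixture φ βstar θstar‖ ≤ C0 * √(s : ℝ) * κ ∧
            |l1norm (βhat ω) - l1norm βstar| ≤ C3 * κ * s := by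

  obtain ⟨M, hM1, hM⟩ := hK.exists_norm_featureDeriv_le
  have hM0 : 0 < M := by linarith
  obtain ⟨ε, hε, hε1, hε2⟩ : ∃ ε : ℝ, 0 < ε ∧ ε * (CN' + cN + 1 / 2) ≤ CN / 2 ∧
      ε * (2 + cF) ≤ CF / 2 := by
    refine ⟨min (CN / 2 / (CN' + cN + 1 / 2)) (CF / 2 / (2 + cF)), by positivity, ?_, ?_⟩
    · rw [← le_div_iff₀ (by positivity)]; exact min_le_left _ _
    · rw [← le_div_iff₀ (by positivity)]; exact min_le_right _ _
  refine ⟨2 * (CB + ε * (CB + cB)), 8 * M / ε, 108, 4 * (CB + ε * (CB + cB)) ^ 2, by positivity,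
    by positivity, by norm_num, by positivity, ?_⟩
  intro H _ _ _ φ a b hφ hB n s γ θ hθ hs hcert hder Ω _ P _ w y σ Δ hσ hΔ hw hy τ κ hτ hκ hκτ
    βhat θhat hest
  -- For `τ < 3` the claimed probability is negative, as `108/τ > 1`, so the empty event suffices;
  -- this includes the default values at `τ ≤ 1`. From `3 > e` on, `log τ ≥ 1`, which chaining
  -- needs.
  rcases lt_or_ge τ 3 with hτ3 | hτ3
  · refine ⟨∅, MeasurableSet.empty, ?_, by simp⟩
    have h1 := le_max_right (dictDist Θ φ a b / (τ * √(Real.log τ))) (1 / τ)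
    have h2 : 1 / 3 ≤ 1 / τ := by gcongr
    rw [measureReal_empty]
    linarith
  have hab : Set.Icc a b ⊆ Θ := hB.subset.trans hK.subset
  -- The interval is nonempty because it contains an active atom, as `s ≥ 1`.
  have hle : a ≤ b := by
    have hne : (θ '' vecSupport γ).ncard ≠ 0 := by
      rw [hcert.sep.card]; have := hcert.sep.one_le; omega
    obtain ⟨q, hq⟩ := Set.nonempty_of_ncard_ne_zero hne
    have := hcert.sep.subset hq
    exact this.1.trans this.2
  have hlog1 : 1 ≤ Real.log τ := by
    rw [Real.le_log_iff_exp_le hτ]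
    linarith [Real.exp_one_lt_d9]
  -- The constant `8 * M / ε` is calibrated so that the chaining exponent is at least `(64/32) * log
  -- τ`.
  have hx : 2 * Real.log τ ≤ (ε * κ) ^ 2 / (32 * (σ ^ 2 * Δ * M ^ 2)) := by
    rw [le_div_iff₀ (by positivity)]
    have h1 : 8 * M * σ * √(Δ * Real.log τ) ≤ ε * κ := by
      calc _ = ε * (8 * M / ε * σ * √(Δ * Real.log τ)) := by field_simp
        _ ≤ _ := by gcongr
    have h2 := pow_le_pow_left₀ (by positivity) h1 2
    rw [mul_pow, Real.sq_sqrt (by positivity)] at h2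
    linarith
  have hd : 0 ≤ dictDist Θ φ a b := abs_nonneg _
  have hP := measure_exists_featureDeriv_lt hφ hle hab hw hσ hΔ hM0
    (hM H φ (Set.Icc a b) hφ hB) (u := ε * κ) (by positivity) (by linarith)
    (mul_div_cancel₀ ((ε * κ) ^ 2) (by positivity))
  refine exists_measurableSet_of_measure_le (P := P) (by positivity)
    (hP.trans (ENNReal.ofReal_le_ofReal (mul_exp_neg_le_max hd hτ3 hx))) ?_
  filter_upwards [hy, hest] with ω hyω hestω hω
  have hsmall : ∀ i < 3, ∀ t ∈ Set.Icc a b,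
      |inner ℝ (featureDeriv Θ φ i t) (w ω)| ≤ ε * κ := fun i hi t ht =>
    not_lt.1 fun hlt => hω ⟨i, hi, t, ht, hlt⟩
  rw [hyω] at hestω
  exact risk_bounds_of_small_noise hr hθ hs hcert hder hκ hCB hcB hε hCN hCF hε1 hε2
    (X₁ := fun t => inner ℝ (featureDeriv Θ φ 1 t) (w ω)) (hsmall 0 (by norm_num))
    (hsmall 1 (by norm_num))
    (fun x hx t ht => hφ.abs_inner_feature_sub_le hab (hsmall 2 (by norm_num)) hx ht) hestω
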